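/- Let $q\in\mathbb{C}$ with $0<|q|<1$ and fix a square root $q^{1/2}$ of $q$, with inverse $q^{-1/2}$. For a meromorphic function $f$ on $\mathbb{C}$ put $\breve f(z)=f\big((z+1/z)/2\big)$, and for $x\in\mathbb{C}$ let $z=x+\sqrt{x^2-1}$, where the branch of the root satisfies $\sqrt{x^2-1}\sim x$ as $x\to\infty$ and is continued to $[-1,1]$ from the upper half plane. The Askey–Wilson operator is $$(\mathcal{D}_qf)(x)=\frac{\breve f(q^{1/2}z)-\breve f(q^{-1/2}z)}{(q^{1/2}-q^{-1/2})(z-1/z)/2}\quad(x\neq\pm1),\qquad (\mathcal{D}_qf)(\pm1)=f'\big(\pm(q^{1/2}+q^{-1/2})/2\big).$$ Let $m(r,f)=\frac1{2\pi}\int_0^{2\pi}\log^+|f(re^{i\theta})|\,d\theta$, let $n(r,f)$ be the number of poles of $f$ in $\{|x|<r\}$, counted with multiplicity, and let $T(r,f)=m(r,f)+\int_0^r\frac{n(t,f)-n(0,f)}{t}\,dt+n(0,f)\log r$ be the Nevanlinna characteristic, where $n(0,f)$ is the multiplicity of the pole of $f$ at $0$. A measurable set $E$ of radii has finite logarithmic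 measure if $\int_{E\cap[1,\infty)}dt/t<\infty$. There are constants $D_\alpha>0$, $0<\alpha<1$, depending only on $\alpha$, such that the following holds. Suppose that $f$ is meromorphic on $\mathbb{C}$ with finite logarithmic order $$\sigma_{\log}=\limsup_{r\to\infty}\frac{\log T(r,f)}{\log\log r}\in\mathbb{R},$$ and that $\mathcal{D}_qf\not\equiv0$. (a) For every $\alpha\in(0,1)$ there is a set $E$ of finite logarithmic measure such that, for all $x$ with $|x|\notin E$ and all $R>2(|q^{1/2}|+|q^{-1/2}|)|x|$, $$\begin{aligned}\log^+\Big|\frac{(\mathcal{D}_qf)(x)}{f(x)}\Big|\le{}&\frac{4R\,(|q^{1/2}-1|+|q^{-1/2}-1|)\,|x|}{(R-|x|)\,[R-2(|q^{1/2}|+|q^{-1/2}|)|x|]}\Big(m(R,f)+m\big(R,\tfrac1f\big)\Big)\\&+2(|q^{1/2}-1|+|q^{-1/2}-1|)\,|x|\Big(\frac1{R-|x|}+\frac1{R-2(|q^{1/2}|+|q^{-1/2}|)|x|}\Big)\Big(n(R,f)+n\big(R,\tfrac1f\big)\Big)\\&+D_\alpha\,(|q^{1/2}-1|^\alpha+|q^{-1/2}-1|^\alpha)\,\big(\log(|x|+3)\big)^{\alpha\sigma_{\log}}\Big(n(R,f)+n\big(R,\tfrac1f\big)\Big)+\log2.\end{aligned}$$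 (b) For every $\varepsilon>0$ there is a set $E$ of finite logarithmic measure such that, as $r\to\infty$ with $r\notin E$, $$\log^+\Big|\frac{(\mathcal{D}_qf)(x)}{f(x)}\Big|=O\big((\log r)^{\sigma_{\log}-1+\varepsilon}\big)\quad\text{uniformly for }|x|=r,$$ and $$m\Big(r,\frac{\mathcal{D}_qf}{f}\Big)=O\big((\log r)^{\sigma_{\log}-1+\varepsilon}\big).$$ -/

import Mathlib

open Filter Topology Asymptotics

noncomputable section

namespace AskeyWilson

/-- The branch `z = x + √(x² - 1)` of the solution of `x = (z + 1/z)/2`. The product of principal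
square roots `√(x - 1) √(x + 1)` is the branch of `√(x² - 1)` on `ℂ \ [-1, 1]` with
`√(x² - 1) ~ x` as `x → ∞`; for `x ∈ [-1, 1]` it equals `i √(1 - x²)`, the limit from above. -/
def zOf (x : ℂ) : ℂ :=
  x + (x - 1) ^ (1 / 2 : ℂ) * (x + 1) ^ (1 / 2 : ℂ)

/-- `f̆(z) = f((z + 1/z)/2)`. -/
def breve (f : ℂ → ℂ) (z : ℂ) : ℂ :=
  f ((z + z⁻¹) / 2)

open Classical in
/-- The Askey-Wilson divided difference operator `𝒟_q`, where `s` is the chosen value of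
`q ^ (1/2)`. At `x = ± 1` it is defined by the limiting value. -/
def awOp (s : ℂ) (f : ℂ → ℂ) (x : ℂ) : ℂ :=
  if x = 1 then deriv f ((s + s⁻¹) / 2)
  else if x = -1 then deriv f (-((s + s⁻¹) / 2))
  else (breve f (s * zOf x) - breve f (s⁻¹ * zOf x)) /
    (breve (fun y => y) (s * zOf x) - breve (fun y => y) (s⁻¹ * zOf x))

/-- The logarithmic order `limsup_{r → ∞} log T(r, f) / log log r`. -/
def logOrder (f : ℂ → ℂ) : EReal :=
  limsup (fun r : ℝ =>
    ((Real.log (ValueDistribution.characteristic f ⊤ r) / Real.log (Real.log r) : ℝ) : EReal)) atTop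

/-- `n(r, f)`: the number of poles of `f` in `{|x| < r}`, counted with multiplicity. -/
def poleCount (f : ℂ → ℂ) (r : ℝ) : ℝ :=
  ((∑ᶠ z ∈ Metric.ball (0 : ℂ) r, ((MeromorphicOn.divisor f Set.univ)⁻ z) : ℤ) : ℝ)

/-- `E` is a (measurable) set of finite logarithmic measure `∫_{E ∩ [1, ∞)} dt / t`. -/
def FiniteLogMeasure (E : Set ℝ) : Prop :=
  MeasurableSet E ∧ ∫⁻ t in E ∩ Set.Ici 1, ENNReal.ofReal (1 / t) < ⊤

end AskeyWilson

end

/-! Write `s` for the chosen root of `q`. For large `x` the quotient `𝒟_q f` is a divided difference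
`(f u - f v) / (u - v)` with `|u - v| ≥ 1`, where `u` and `v` lie within bounded distance of `s x`
and `s⁻¹ x`. Hence `log⁺ |𝒟_q f / f|` at `x` is at most `log⁺ |f u / f x| + log⁺ |f v / f x| + log
2`, and it remains to bound one such quotient (`posLog_norm_div_le`).

Subtracting the Poisson-Jensen formulas at `u` and `x` on the disk of radius `R` leaves two terms.
The difference of the Poisson kernels is integrated against `|log |f|| = log⁺ |f| + log⁺ |1/f|` and
gives the proximity term. Each zero or pole `i` contributes a difference of logarithms of Blaschke
factors: a harmless part of size `|u - x| / (R - |·|)` and a part `log (1 + δ) ≤ δ ^ α / α`, where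
`δ` compares `|u - x|` with the distances from `i` to `x` and `u`.

Those distances are at least `|x| / (log (|x| + 3)) ^ σ` unless `|x|`, `|s| |x|` or `|s⁻¹| |x|` is
too close to the modulus of a zero or pole. `finiteLogMeasure_near` shows that such radii have
finite logarithmic measure: there are only `O((log ρ) ^ (σ - 1/2))` zeros and poles up to `ρ`, and
`σ - 1/2 < σ`. Countably many further radii are discarded so that `f` is analytic and nonzero at
`x`, `u` and `v`.

For (b), take `R = |x| ^ 2` and `α` small. Counting functions are one power of `log r` smaller than
the characteristic, and the proximity term carries a factor `O(1 / r)`. The bounds need `σ ≥ 1`,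
which holds unless `f` is constant off a discrete set; in that case `𝒟_q f` vanishes outside a small
set of radii. -/

namespace AskeyWilson

/-! ### Poisson-Jensen formula and quotients of two values of a meromorphic function -/

open Complex MeromorphicOn Metric Real in
/-- **Poisson-Jensen formula** on a disk centred at the origin, at a point which is neither a zero
nor a pole. Zeros and poles on the boundary circle are allowed. -/
theorem poisson_jensen {f : ℂ → ℂ} {R : ℝ} {w : ℂ} (hf : MeromorphicOn f (closedBall 0 R))
    (hord : ∀ u : closedBall (0 : ℂ) R, meromorphicOrderAt f u ≠ ⊤) (hw : w ∈ ball (0 : ℂ) R)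
    (hfw : AnalyticAt ℂ f w) (hfw0 : f w ≠ 0) :
    Real.log ‖f w‖ =
      circleAverage ((Complex.re ∘ herglotzRieszKernel 0 w) * (fun z => Real.log ‖f z‖)) 0 R
        - ∑ᶠ i, (divisor f (ball 0 R) i) * Real.log ‖canonicalFactor R i w‖ := by
  have hR : 0 < R := pos_of_mem_ball hw
  -- Dividing out the Blaschke factors of the interior divisor and the linear factors of the
  -- boundary divisor leaves `h`, analytic and zero-free on the closed disk.
  obtain ⟨h, D⟩ := hf.exists_ecanonicalDecomp hord
  have key : ∀ ζ ∈ closedBall (0 : ℂ) R, AnalyticAt ℂ f ζ → f ζ ≠ 0 →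
      Real.log ‖h ζ‖ = ((∑ᶠ i, (divisor f (ball 0 R) i) * Real.log ‖canonicalFactor R i ζ‖)
          - (∑ᶠ i, (divisor f (sphere 0 R) i) * Real.log ‖ζ - i‖)) + Real.log ‖f ζ‖ := by
    intro ζ hζ han hne
    rw [D.log_norm_eq hζ (han.meromorphicNFAt.meromorphicOrderAt_eq_zero_iff.2 hne) hR,
      han.meromorphicTrailingCoeffAt_of_ne_zero hne]
  have hfin : (divisor f (sphere 0 R)).support.Finite := divisor_sphere_support_finite
  set S : Finset ℂ := hfin.toFinset with hS
  have hsum : ∀ ζ : ℂ, (∑ᶠ i, (divisor f (sphere 0 R) i) * Real.log ‖ζ - i‖)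
      = ∑ i ∈ S, (divisor f (sphere 0 R) i) * Real.log ‖ζ - i‖ := by
    intro ζ
    refine finsum_eq_sum_of_support_subset _ ?_
    intro i hi
    simp only [Function.mem_support, ne_eq, mul_eq_zero, not_or, Int.cast_eq_zero] at hi
    simp [hS, hi.1]
  have hker : ContinuousOn (Complex.re ∘ herglotzRieszKernel 0 w) (sphere 0 |R|) :=
    Complex.continuous_re.comp_continuousOn (continuousOn_herglotzRieszKernel_sphere hw)
  -- On the circle the Blaschke factors have modulus one, so off a discrete set only `h` and the
  -- boundary factors contribute to `log |f|`.
  have hcong : ((Complex.re ∘ herglotzRieszKernel 0 w) * (fun z => Real.log ‖f z‖))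
      =ᶠ[codiscreteWithin (sphere (0 : ℂ) |R|)]
      ((Complex.re ∘ herglotzRieszKernel 0 w) * (fun z => Real.log ‖h z‖) +
        ∑ i ∈ S, (divisor f (sphere 0 R) i : ℝ) •
          ((Complex.re ∘ herglotzRieszKernel 0 w) * (fun z => Real.log ‖z - i‖))) := by
    have hfR : MeromorphicOn f (closedBall 0 |R|) := by rwa [abs_of_pos hR]
    have h1 : ∀ᶠ z in codiscreteWithin (closedBall (0 : ℂ) |R|), f z ≠ 0 :=
      hfR.eventually_codiscreteWithin_apply_ne_zero fun z hz => by
        rw [abs_of_pos hR] at hz; exact hord ⟨z, hz⟩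
    have h2 := eventually_codiscreteWithin_analyticAt f hfR
    have hle := codiscreteWithin_mono (sphere_subset_closedBall (x := (0 : ℂ)) (ε := |R|))
    filter_upwards [hle h1, hle h2, self_mem_codiscreteWithin _] with z hz1 hz2 hz3
    rw [abs_of_pos hR] at hz3
    have h0 : (∑ᶠ i, (divisor f (ball 0 R) i) * Real.log ‖canonicalFactor R i z‖) = 0 := by
      refine finsum_eq_zero_of_forall_eq_zero fun i => ?_
      by_cases hi : i ∈ ball (0 : ℂ) R
      · rw [norm_canonicalFactor_eval_circle_eq_one hi hz3, Real.log_one, mul_zero]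
      · simp [hi]
    have hk := key z (sphere_subset_closedBall hz3) hz2 hz1
    rw [h0, hsum] at hk
    simp only [Pi.mul_apply, Pi.add_apply, Finset.sum_apply, Pi.smul_apply, smul_eq_mul, hk]
    rw [Finset.sum_congr rfl fun i _ => mul_left_comm _ _ _, ← Finset.mul_sum]
    ring
  have hlogint : ∀ i : ℂ, CircleIntegrable
      ((Complex.re ∘ herglotzRieszKernel 0 w) * (fun z => Real.log ‖z - i‖)) 0 R := fun i =>
    CircleIntegrable.continuousOn_mul (circleIntegrable_log_norm_sub_const R) hker
  have hh : ∀ z ∈ closedBall (0 : ℂ) R, InnerProductSpace.HarmonicAt (fun z => Real.log ‖h z‖) z :=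
    fun z hz => (D.analyticOnNhd z hz).harmonicAt_log_norm (D.ne_zero z hz)
  have hhint : CircleIntegrable
      ((Complex.re ∘ herglotzRieszKernel 0 w) * (fun z => Real.log ‖h z‖)) 0 R := by
    refine CircleIntegrable.continuousOn_mul (MeromorphicOn.circleIntegrable_log_norm ?_) hker
    rw [abs_of_pos hR]
    exact (D.analyticOnNhd.mono sphere_subset_closedBall).meromorphicOn
  have hpoisson : circleAverage
      ((Complex.re ∘ herglotzRieszKernel 0 w) * (fun z => Real.log ‖h z‖)) 0 R
        = Real.log ‖h w‖ :=
    InnerProductSpace.HarmonicOnNhd.circleAverage_re_herglotzRieszKernel_smul hh hw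
  rw [circleAverage_congr_codiscreteWithin hcong hR.ne', circleAverage_add hhint
    (CircleIntegrable.sum _ fun i _ => (hlogint i).const_smul), hpoisson,
    circleAverage_sum fun i _ => (hlogint i).const_smul, key w (ball_subset_closedBall hw) hfw hfw0,
    hsum]
  -- The Poisson integral reproduces `log |w - i|` even when the singularity `i` lies on the circle,
  -- so the boundary terms cancel.
  have : ∀ i ∈ S, circleAverage ((divisor f (sphere 0 R) i : ℝ) •
      ((Complex.re ∘ herglotzRieszKernel 0 w) * (fun z => Real.log ‖z - i‖))) 0 R
        = (divisor f (sphere 0 R) i) * Real.log ‖w - i‖ := by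
    intro i hi
    have hi' : i ∈ sphere (0 : ℂ) R :=
      (divisor f (sphere 0 R)).supportWithinDomain (by simpa [hS] using hi)
    rw [circleAverage_smul, circleAverage_re_herglotzRieszKernel_mul_log hi' hw, smul_eq_mul]
  rw [Finset.sum_congr rfl this]
  ring

open Complex Metric Real in
lemma abs_re_herglotzRieszKernel_sub_le {R : ℝ} {x u ζ : ℂ} (hx : ‖x‖ < R) (hu : ‖u‖ < R)
    (hζ : ‖ζ‖ = R) :
    |(herglotzRieszKernel 0 u ζ).re - (herglotzRieszKernel 0 x ζ).re| ≤
      2 * R * ‖u - x‖ / ((R - ‖x‖) * (R - ‖u‖)) := by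
  have hx1 : R - ‖x‖ ≤ ‖ζ - x‖ := by rw [← hζ]; exact norm_sub_norm_le _ _
  have hu1 : R - ‖u‖ ≤ ‖ζ - u‖ := by rw [← hζ]; exact norm_sub_norm_le _ _
  have hx2 : ζ - x ≠ 0 := norm_pos_iff.1 (by linarith)
  have hu2 : ζ - u ≠ 0 := norm_pos_iff.1 (by linarith)
  have hR : 0 ≤ R := (norm_nonneg x).trans hx.le
  have h : herglotzRieszKernel 0 u ζ - herglotzRieszKernel 0 x ζ
      = 2 * ζ * (u - x) / ((ζ - x) * (ζ - u)) := by
    simp only [herglotzRieszKernel_def, sub_zero]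
    field_simp
    ring
  rw [← Complex.sub_re, h]
  refine (Complex.abs_re_le_norm _).trans ?_
  rw [norm_div, norm_mul, norm_mul, norm_mul, hζ]
  have h1 : 0 < R - ‖x‖ := by linarith
  have h2 : 0 < R - ‖u‖ := by linarith
  simp only [Complex.norm_ofNat]
  gcongr

lemma posLog_add_posLog_inv (t : ℝ) : Real.posLog t + Real.posLog t⁻¹ = |Real.log t| := by
  rw [← Real.half_mul_log_add_log_abs, ← Real.half_mul_log_add_log_abs, Real.log_inv, abs_neg]
  ring

/-- The difference of the Poisson integrals of `log |f|` at two points is bounded by the proximity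
functions. -/
lemma circleAverage_herglotz_sub_le {f : ℂ → ℂ} {R : ℝ} {x u : ℂ} (hf : Meromorphic f)
    (hx : ‖x‖ < R) (hu : ‖u‖ < R) :
    Real.circleAverage ((Complex.re ∘ herglotzRieszKernel 0 u) * (fun z => Real.log ‖f z‖)) 0 R
      - Real.circleAverage ((Complex.re ∘ herglotzRieszKernel 0 x) * (fun z => Real.log ‖f z‖)) 0 R
      ≤ 2 * R * ‖u - x‖ / ((R - ‖x‖) * (R - ‖u‖)) *
        (ValueDistribution.proximity f ⊤ R + ValueDistribution.proximity f⁻¹ ⊤ R) := by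
  have hR : 0 < R := (norm_nonneg x).trans_lt hx
  have hker : ∀ w : ℂ, ‖w‖ < R →
      ContinuousOn (Complex.re ∘ herglotzRieszKernel 0 w) (Metric.sphere 0 |R|) := fun w hw =>
    Complex.continuous_re.comp_continuousOn
      (continuousOn_herglotzRieszKernel_sphere (by simpa using hw))
  have hint : CircleIntegrable (fun z => Real.log ‖f z‖) 0 R :=
    hf.meromorphicOn.circleIntegrable_log_norm
  have hp : CircleIntegrable (fun z => Real.posLog ‖f z‖) 0 R :=
    hf.meromorphicOn.circleIntegrable_posLog_norm
  have hpi : CircleIntegrable (fun z => Real.posLog ‖f⁻¹ z‖) 0 R :=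
    hf.inv.meromorphicOn.circleIntegrable_posLog_norm
  have hu' := hint.continuousOn_mul (hker u hu)
  have hx' := hint.continuousOn_mul (hker x hx)
  rw [← Real.circleAverage_sub hu' hx', ValueDistribution.proximity_top,
    ValueDistribution.proximity_top, ← Real.circleAverage_add hp hpi, ← smul_eq_mul (a := _ / _),
    ← Real.circleAverage_smul]
  refine Real.circleAverage_mono (hu'.sub hx') ((hp.add hpi).const_smul) fun ζ hζ => ?_
  have hζ' : ‖ζ‖ = R := by simpa [abs_of_pos hR] using hζ
  simp only [Pi.sub_apply, Pi.mul_apply, Function.comp_apply, Pi.smul_apply, Pi.add_apply,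
    smul_eq_mul, Pi.inv_apply, norm_inv]
  rw [← sub_mul, posLog_add_posLog_inv]
  refine (le_abs_self _).trans ?_
  rw [abs_mul]
  exact mul_le_mul_of_nonneg_right (abs_re_herglotzRieszKernel_sub_le hx hu hζ') (abs_nonneg _)

/-- Take logarithms in `(1 + t) ^ α ≤ 1 + t ^ α`. The factor `1 / α` lost here is the origin of the
constant `D_α`. -/
lemma log_one_add_le_rpow {t α : ℝ} (ht : 0 ≤ t) (hα : 0 < α) (hα1 : α < 1) :
    Real.log (1 + t) ≤ t ^ α / α := by
  have h1 : (1 + t) ^ α ≤ 1 + t ^ α := by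
    simpa using Real.rpow_add_le_add_rpow zero_le_one ht hα.le hα1.le
  have h2 := Real.log_le_log (by positivity) h1
  rw [Real.log_rpow (by positivity)] at h2
  have h3 : Real.log (1 + t ^ α) ≤ t ^ α := by
    have := Real.log_le_sub_one_of_pos (x := 1 + t ^ α) (by positivity)
    linarith
  rw [le_div_iff₀ hα]
  linarith

lemma log_norm_sub_log_norm_le {a b : ℂ} {t : ℝ} (ha : a ≠ 0) (hb : b ≠ 0)
    (h : ‖a - b‖ ≤ t * ‖b‖) : Real.log ‖a‖ - Real.log ‖b‖ ≤ Real.log (1 + t) := by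
  have hb' : 0 < ‖b‖ := norm_pos_iff.2 hb
  rw [← Real.log_div (norm_ne_zero_iff.2 ha) hb'.ne']
  refine Real.log_le_log (div_pos (norm_pos_iff.2 ha) hb') ?_
  rw [div_le_iff₀ hb']
  have := norm_add_le (a - b) b
  rw [sub_add_cancel] at this
  linarith

/-- The contribution of a single zero or pole `i` to the difference of two Blaschke sums. -/
lemma log_canonicalFactor_sub_le {R α δ : ℝ} {x u i : ℂ} (hx : ‖x‖ < R) (hu : ‖u‖ < R)
    (hi : ‖i‖ < R) (hxi : x ≠ i) (hui : u ≠ i) (hα : 0 < α) (hα1 : α < 1) (hδ : 0 ≤ δ)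
    (h : ‖u - x‖ ≤ δ * ‖x - i‖) :
    Real.log ‖Complex.canonicalFactor R i x‖ - Real.log ‖Complex.canonicalFactor R i u‖ ≤
      ‖u - x‖ / (R - ‖u‖) + δ ^ α / α := by
  have hR : 0 < R := (norm_nonneg x).trans_lt hx
  have hR' : (R : ℂ) ≠ 0 := by exact_mod_cast hR.ne'
  have hnum : ∀ w : ℂ, ‖w‖ < R →
      R * (R - ‖w‖) ≤ ‖(R : ℂ) ^ 2 - (starRingEnd ℂ) i * w‖ := by
    intro w hw
    have h1 := norm_sub_norm_le ((R : ℂ) ^ 2) ((starRingEnd ℂ) i * w)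
    rw [norm_pow, norm_mul, Complex.norm_conj, Complex.norm_real, Real.norm_of_nonneg hR.le] at h1
    nlinarith [norm_nonneg w, norm_nonneg i]
  have hpos : ∀ w : ℂ, ‖w‖ < R → (R : ℂ) ^ 2 - (starRingEnd ℂ) i * w ≠ 0 := fun w hw =>
    norm_pos_iff.1 (lt_of_lt_of_le (mul_pos hR (by linarith)) (hnum w hw))
  have hlog : ∀ w : ℂ, ‖w‖ < R → w ≠ i → Real.log ‖Complex.canonicalFactor R i w‖ =
      Real.log ‖(R : ℂ) ^ 2 - (starRingEnd ℂ) i * w‖ - (Real.log ‖(R : ℂ)‖ + Real.log ‖w - i‖) := by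
    intro w hw hwi
    rw [Complex.canonicalFactor_apply, norm_div, norm_mul, Real.log_div (norm_ne_zero_iff.2 (hpos w hw))
      (mul_ne_zero (norm_ne_zero_iff.2 hR') (norm_ne_zero_iff.2 (sub_ne_zero.2 hwi))),
      Real.log_mul (norm_ne_zero_iff.2 hR') (norm_ne_zero_iff.2 (sub_ne_zero.2 hwi))]
  rw [hlog x hx hxi, hlog u hu hui]
  have hu0 : 0 < R - ‖u‖ := by linarith
  -- The numerators stay at least `R (R - |w|)` wherever `i` is, so closeness to `i` matters only
  -- for the denominators.
  have h1 : Real.log ‖(R : ℂ) ^ 2 - (starRingEnd ℂ) i * x‖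
      - Real.log ‖(R : ℂ) ^ 2 - (starRingEnd ℂ) i * u‖ ≤ ‖u - x‖ / (R - ‖u‖) := by
    have hstep := log_norm_sub_log_norm_le (t := ‖u - x‖ / (R - ‖u‖)) (hpos x hx) (hpos u hu) (by
      have e : (R : ℂ) ^ 2 - (starRingEnd ℂ) i * x - ((R : ℂ) ^ 2 - (starRingEnd ℂ) i * u)
          = (starRingEnd ℂ) i * (u - x) := by ring
      rw [e, norm_mul, Complex.norm_conj]
      calc ‖i‖ * ‖u - x‖ ≤ R * ‖u - x‖ := by gcongr
        _ = ‖u - x‖ / (R - ‖u‖) * (R * (R - ‖u‖)) := by field_simp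
        _ ≤ _ := by gcongr; exact hnum u hu)
    have h3 : 0 < 1 + ‖u - x‖ / (R - ‖u‖) := by positivity
    linarith [Real.log_le_sub_one_of_pos h3]
  have h2 : Real.log ‖u - i‖ - Real.log ‖x - i‖ ≤ δ ^ α / α :=
    (log_norm_sub_log_norm_le (sub_ne_zero.2 hui) (sub_ne_zero.2 hxi)
      (by simpa using h)).trans (log_one_add_le_rpow hδ hα hα1)
  linarith

/-- Inversion negates the divisor, and the negative parts of `D` and `-D` add up to `|D|`. -/
lemma poleCount_eq_finsum {f : ℂ → ℂ} {R : ℝ} (hf : Meromorphic f) :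
    poleCount f R + poleCount f⁻¹ R =
      ∑ᶠ i, |(MeromorphicOn.divisor f (Metric.ball 0 R) i : ℝ)| := by
  have hmo : ∀ U, MeromorphicOn f U := fun U => hf.meromorphicOn
  have hfin : (MeromorphicOn.divisor f (Metric.ball 0 R)).support.Finite :=
    (hmo (Metric.closedBall 0 R)).divisor_ball_support_finite
  have hval : ∀ z ∈ Metric.ball (0 : ℂ) R, MeromorphicOn.divisor f Set.univ z
      = MeromorphicOn.divisor f (Metric.ball 0 R) z := by
    intro z hz
    rw [(hmo _).divisor_apply (Set.mem_univ z), (hmo _).divisor_apply hz]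
  have hgen : ∀ D : Function.locallyFinsuppWithin (Set.univ : Set ℂ) ℤ,
      (∀ z ∈ Metric.ball (0 : ℂ) R, MeromorphicOn.divisor f (Metric.ball 0 R) z = 0 → D z = 0) →
      ∑ᶠ z ∈ Metric.ball (0 : ℂ) R, D z
        = ∑ z ∈ hfin.toFinset, D z := by
    intro D hD
    refine finsum_mem_eq_sum_of_inter_support_eq _ ?_
    ext z
    simp only [Set.mem_inter_iff, Function.mem_support, Set.Finite.coe_toFinset]
    refine ⟨fun h => ⟨fun h0 => h.2 (hD z h.1 h0), h.2⟩, fun h => ⟨?_, h.2⟩⟩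
    exact (MeromorphicOn.divisor f (Metric.ball 0 R)).supportWithinDomain h.1
  have hsub : ∑ᶠ i, |(MeromorphicOn.divisor f (Metric.ball 0 R) i : ℝ)|
      = ∑ i ∈ hfin.toFinset, |(MeromorphicOn.divisor f (Metric.ball 0 R) i : ℝ)| := by
    refine finsum_eq_sum_of_support_subset _ fun i hi => ?_
    simpa using hi
  rw [hsub, poleCount, poleCount, MeromorphicOn.divisor_inv, hgen, hgen]
  · push_cast
    rw [← Finset.sum_add_distrib]
    refine Finset.sum_congr rfl fun z hz => ?_
    have hz' : z ∈ Metric.ball (0 : ℂ) R :=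
      (MeromorphicOn.divisor f (Metric.ball 0 R)).supportWithinDomain (by simpa using hz)
    rw [← hval z hz', ← Int.cast_abs, ← Int.cast_add]
    congr 1
    rw [Function.locallyFinsuppWithin.negPart_apply, Function.locallyFinsuppWithin.negPart_apply,
      Function.locallyFinsuppWithin.coe_neg, Pi.neg_apply, negPart_neg, add_comm,
      posPart_add_negPart]
  · intro z hz h0
    rw [Function.locallyFinsuppWithin.negPart_apply, Function.locallyFinsuppWithin.coe_neg,
      Pi.neg_apply, hval z hz, h0]
    simp
  · intro z hz h0
    rw [Function.locallyFinsuppWithin.negPart_apply, hval z hz, h0]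
    simp

/-- Pointwise estimate for a quotient of two values of a meromorphic function. -/
theorem posLog_norm_div_le {f : ℂ → ℂ} {R α δ : ℝ} {x u : ℂ} (hf : Meromorphic f)
    (hord : ∀ z, meromorphicOrderAt f z ≠ ⊤) (hx : ‖x‖ < R) (hu : ‖u‖ < R)
    (hfx : AnalyticAt ℂ f x) (hfx0 : f x ≠ 0) (hfu : AnalyticAt ℂ f u) (hfu0 : f u ≠ 0)
    (hα : 0 < α) (hα1 : α < 1) (hδ : 0 ≤ δ)
    (hdx : ∀ i, MeromorphicOn.divisor f Set.univ i ≠ 0 → ‖u - x‖ ≤ δ * ‖x - i‖)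
    (hdu : ∀ i, MeromorphicOn.divisor f Set.univ i ≠ 0 → ‖u - x‖ ≤ δ * ‖u - i‖) :
    Real.posLog ‖f u / f x‖ ≤
      2 * R * ‖u - x‖ / ((R - ‖x‖) * (R - ‖u‖)) *
        (ValueDistribution.proximity f ⊤ R + ValueDistribution.proximity f⁻¹ ⊤ R)
      + (‖u - x‖ * (1 / (R - ‖x‖) + 1 / (R - ‖u‖)) + δ ^ α / α) *
        (poleCount f R + poleCount f⁻¹ R) := by
  have hR : 0 < R := (norm_nonneg x).trans_lt hx
  have hx0 : 0 < R - ‖x‖ := by linarith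
  have hu0 : 0 < R - ‖u‖ := by linarith
  set D := MeromorphicOn.divisor f (Metric.ball 0 R) with hDdef
  have hfin : D.support.Finite :=
    (hf.meromorphicOn (s := Metric.closedBall 0 R)).divisor_ball_support_finite
  have hDmem : ∀ i ∈ hfin.toFinset, ‖i‖ < R ∧ MeromorphicOn.divisor f Set.univ i ≠ 0 := by
    intro i hi
    have hi0 : D i ≠ 0 := by simpa using hi
    have hib : i ∈ Metric.ball (0 : ℂ) R := D.supportWithinDomain hi0
    refine ⟨by simpa using hib, ?_⟩
    rwa [hf.meromorphicOn.divisor_apply (Set.mem_univ i), ← hf.meromorphicOn.divisor_apply hib]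
  have hne : ∀ w, AnalyticAt ℂ f w → f w ≠ 0 → ∀ i ∈ hfin.toFinset, w ≠ i := by
    rintro w hw hw0 i hi rfl
    refine (hDmem w hi).2 ?_
    rw [hf.meromorphicOn.divisor_apply (Set.mem_univ w),
      hw.meromorphicNFAt.meromorphicOrderAt_eq_zero_iff.2 hw0]
    rfl
  have hsum : ∀ w : ℂ, (∑ᶠ i, (D i) * Real.log ‖Complex.canonicalFactor R i w‖)
      = ∑ i ∈ hfin.toFinset, (D i) * Real.log ‖Complex.canonicalFactor R i w‖ := by
    intro w
    refine finsum_eq_sum_of_support_subset _ fun i hi => ?_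
    simp only [Function.mem_support, ne_eq, mul_eq_zero, not_or, Int.cast_eq_zero] at hi
    simp [hi.1]
  have hJu := poisson_jensen (hf.meromorphicOn (s := Metric.closedBall 0 R))
    (fun z => hord z) (by simpa using hu) hfu hfu0
  have hJx := poisson_jensen (hf.meromorphicOn (s := Metric.closedBall 0 R))
    (fun z => hord z) (by simpa using hx) hfx hfx0
  rw [← hDdef, hsum] at hJu hJx
  have hint := circleAverage_herglotz_sub_le hf hx hu
  set c := ‖u - x‖ * (1 / (R - ‖x‖) + 1 / (R - ‖u‖)) + δ ^ α / α with hc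
  have hc0 : 0 ≤ c := by positivity
  have hterm : ∀ i ∈ hfin.toFinset, (D i) * Real.log ‖Complex.canonicalFactor R i x‖
      - (D i) * Real.log ‖Complex.canonicalFactor R i u‖ ≤ c * |(D i : ℝ)| := by
    intro i hi
    obtain ⟨hiR, hiD⟩ := hDmem i hi
    have h1 := log_canonicalFactor_sub_le hx hu hiR (hne x hfx hfx0 i hi) (hne u hfu hfu0 i hi)
      hα hα1 hδ (hdx i hiD)
    have h2 := log_canonicalFactor_sub_le hu hx hiR (hne u hfu hfu0 i hi) (hne x hfx hfx0 i hi)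
      hα hα1 hδ (by rw [norm_sub_rev]; exact hdu i hiD)
    rw [norm_sub_rev x u] at h2
    -- A two-sided bound is needed because `D i` is positive at zeros and negative at poles.
    have h3 : |Real.log ‖Complex.canonicalFactor R i x‖
        - Real.log ‖Complex.canonicalFactor R i u‖| ≤ c := by
      have e : c = ‖u - x‖ / (R - ‖x‖) + ‖u - x‖ / (R - ‖u‖) + δ ^ α / α := by rw [hc]; ring
      have p1 : 0 ≤ ‖u - x‖ / (R - ‖x‖) := by positivity
      have p2 : 0 ≤ ‖u - x‖ / (R - ‖u‖) := by positivity
      rw [abs_le]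
      constructor <;> linarith
    calc _ = (D i : ℝ) * (Real.log ‖Complex.canonicalFactor R i x‖
        - Real.log ‖Complex.canonicalFactor R i u‖) := by ring
      _ ≤ |(D i : ℝ)| * |Real.log ‖Complex.canonicalFactor R i x‖
        - Real.log ‖Complex.canonicalFactor R i u‖| := by
          rw [← abs_mul]; exact le_abs_self _
      _ ≤ c * |(D i : ℝ)| := by rw [mul_comm]; gcongr
  have hS := Finset.sum_le_sum hterm
  rw [Finset.sum_sub_distrib, ← Finset.mul_sum] at hS
  have hN : poleCount f R + poleCount f⁻¹ R = ∑ i ∈ hfin.toFinset, |(D i : ℝ)| := by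
    rw [poleCount_eq_finsum hf]
    exact finsum_eq_sum_of_support_subset _ fun i hi => by simpa using hi
  rw [Real.posLog_apply]
  refine max_le ?_ ?_
  · have := ValueDistribution.proximity_nonneg (f := f) (a := ⊤) R
    have := ValueDistribution.proximity_nonneg (f := f⁻¹) (a := ⊤) R
    rw [hN]
    simp only [Pi.zero_apply] at *
    positivity
  · rw [norm_div, Real.log_div (norm_ne_zero_iff.2 hfu0) (norm_ne_zero_iff.2 hfx0), hN]
    linarith

/-! ### The Askey-Wilson operator as a divided difference -/

lemma zOf_mul_sub (x : ℂ) :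
    zOf x * (x - (x - 1) ^ (1 / 2 : ℂ) * (x + 1) ^ (1 / 2 : ℂ)) = 1 := by
  have h : ∀ y : ℂ, (y ^ (1 / 2 : ℂ)) ^ 2 = y := fun y => by
    simp
  have h1 := h (x - 1)
  have h2 := h (x + 1)
  rw [zOf]
  linear_combination (-((x + 1) ^ (1 / 2 : ℂ)) ^ 2) * h1 - (x - 1) * h2

lemma zOf_ne_zero (x : ℂ) : zOf x ≠ 0 := left_ne_zero_of_mul_eq_one (zOf_mul_sub x)

lemma zOf_add_inv (x : ℂ) : zOf x + (zOf x)⁻¹ = 2 * x := by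
  rw [inv_eq_of_mul_eq_one_right (zOf_mul_sub x), zOf]
  ring

/-- Replacing `z` by `z⁻¹` interchanges the two shifted points and leaves the quotient unchanged, so
`1 ≤ ‖z‖` may be assumed without studying the branch. -/
lemma exists_awOp_eq (s x : ℂ) (h1 : x ≠ 1) (h2 : x ≠ -1) :
    ∃ z : ℂ, z ≠ 0 ∧ 1 ≤ ‖z‖ ∧ z + z⁻¹ = 2 * x ∧ ∀ f : ℂ → ℂ,
      awOp s f x = (f ((s * z + s⁻¹ * z⁻¹) / 2) - f ((s⁻¹ * z + s * z⁻¹) / 2)) /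
        ((s * z + s⁻¹ * z⁻¹) / 2 - (s⁻¹ * z + s * z⁻¹) / 2) := by
  have hz := zOf_ne_zero x
  have hf : ∀ f : ℂ → ℂ, awOp s f x =
      (f ((s * zOf x + s⁻¹ * (zOf x)⁻¹) / 2) - f ((s⁻¹ * zOf x + s * (zOf x)⁻¹) / 2)) /
        ((s * zOf x + s⁻¹ * (zOf x)⁻¹) / 2 - (s⁻¹ * zOf x + s * (zOf x)⁻¹) / 2) := by
    intro f
    simp only [awOp, h1, h2, if_false, breve, mul_inv, inv_inv]
  rcases le_total 1 ‖zOf x‖ with h | h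
  · exact ⟨zOf x, hz, h, zOf_add_inv x, hf⟩
  · refine ⟨(zOf x)⁻¹, inv_ne_zero hz, ?_, ?_, fun f => ?_⟩
    · rw [norm_inv]
      exact one_le_inv_iff₀.2 ⟨norm_pos_iff.2 hz, h⟩
    · rw [inv_inv, add_comm, zOf_add_inv]
    · rw [hf f, inv_inv, add_comm (s * (zOf x)⁻¹), add_comm (s⁻¹ * (zOf x)⁻¹), ← neg_sub, neg_div,
        ← div_neg, neg_sub]

/-- For large `x` the Askey-Wilson quotient is a divided difference of `f` at two points close to
`s x` and `s⁻¹ x`, each algebraically related to `x`. -/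
theorem exists_awOp_points {s : ℂ} (hs0 : s ≠ 0) (hs1 : ‖s‖ < 1) :
    ∃ r₀ : ℝ, 1 ≤ r₀ ∧ ∀ x : ℂ, r₀ ≤ ‖x‖ → ∃ u v : ℂ,
      (∀ f : ℂ → ℂ, awOp s f x = (f u - f v) / (u - v)) ∧ 1 ≤ ‖u - v‖ ∧
      (‖u - x‖ ≤ (‖s - 1‖ + ‖s⁻¹ - 1‖) * ‖x‖ ∧ ‖u‖ ≤ 2 * (‖s‖ + ‖s⁻¹‖) * ‖x‖ ∧
        |‖u‖ - ‖s‖ * ‖x‖| ≤ ‖s‖ + ‖s⁻¹‖ ∧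
        x ^ 2 - (s + s⁻¹) * u * x + (u ^ 2 + ((s - s⁻¹) / 2) ^ 2) = 0) ∧
      (‖v - x‖ ≤ (‖s - 1‖ + ‖s⁻¹ - 1‖) * ‖x‖ ∧ ‖v‖ ≤ 2 * (‖s‖ + ‖s⁻¹‖) * ‖x‖ ∧
        |‖v‖ - ‖s⁻¹‖ * ‖x‖| ≤ ‖s‖ + ‖s⁻¹‖ ∧
        x ^ 2 - (s + s⁻¹) * v * x + (v ^ 2 + ((s - s⁻¹) / 2) ^ 2) = 0) := by
  have hsi : 1 < ‖s⁻¹‖ := by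
    rw [norm_inv]
    exact (one_lt_inv₀ (norm_pos_iff.2 hs0)).2 hs1
  have ha : 0 < ‖s - 1‖ := norm_pos_iff.2 (sub_ne_zero.2 (by rintro rfl; simp at hs1))
  have hb : 0 < ‖s⁻¹ - 1‖ :=
    norm_pos_iff.2 (sub_ne_zero.2 (fun h => by rw [h] at hsi; simp at hsi))
  have hc : 0 < ‖s - s⁻¹‖ :=
    norm_pos_iff.2 (sub_ne_zero.2 (fun h => by rw [← h] at hsi; linarith))
  have hcB : ‖s - s⁻¹‖ ≤ ‖s‖ + ‖s⁻¹‖ := norm_sub_le _ _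
  set B := ‖s‖ + ‖s⁻¹‖ with hB
  have hB1 : 1 ≤ B := by have := norm_nonneg s; linarith
  -- The second summand makes `|u - v| ≥ 1`; the last two let `A |x|`, with `A = |s - 1| + |s⁻¹ -
  -- 1|`, absorb the deviation of `u` and `v` from `s x` and `s⁻¹ x`.
  refine ⟨2 + ‖s - s⁻¹‖⁻¹ + ‖s - s⁻¹‖ / ‖s - 1‖ + ‖s - s⁻¹‖ / ‖s⁻¹ - 1‖, ?_, fun x hx => ?_⟩
  · have : 0 ≤ ‖s - s⁻¹‖⁻¹ + ‖s - s⁻¹‖ / ‖s - 1‖ + ‖s - s⁻¹‖ / ‖s⁻¹ - 1‖ := by positivity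
    linarith
  have p1 : 0 < ‖s - s⁻¹‖⁻¹ := by positivity
  have p2 : 0 < ‖s - s⁻¹‖ / ‖s - 1‖ := by positivity
  have p3 : 0 < ‖s - s⁻¹‖ / ‖s⁻¹ - 1‖ := by positivity
  have hx2 : 2 ≤ ‖x‖ := by linarith
  have hxa : ‖s - s⁻¹‖ ≤ ‖s - 1‖ * ‖x‖ := by
    rw [mul_comm, ← div_le_iff₀ ha]; linarith
  have hxb : ‖s - s⁻¹‖ ≤ ‖s⁻¹ - 1‖ * ‖x‖ := by
    rw [mul_comm, ← div_le_iff₀ hb]; linarith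
  have hxc : 1 ≤ ‖s - s⁻¹‖ * (‖x‖ - 1) := by
    have : ‖s - s⁻¹‖ * ‖s - s⁻¹‖⁻¹ = 1 := mul_inv_cancel₀ hc.ne'
    nlinarith
  obtain ⟨z, hz, hz1, hzx, hf⟩ := exists_awOp_eq s x
    (by rintro rfl; norm_num at hx2) (by rintro rfl; norm_num at hx2)
  have hy1 : ‖z⁻¹‖ ≤ 1 := by
    rw [norm_inv]; exact inv_le_one_of_one_le₀ hz1
  have hzy : z * z⁻¹ = 1 := mul_inv_cancel₀ hz
  have hss : s * s⁻¹ = 1 := mul_inv_cancel₀ hs0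
  -- With `y = z⁻¹` and `z = 2 x - y`, both points are linear in `x` and the bounded quantity `y`.
  generalize z⁻¹ = y at *
  have hzeq : z = 2 * x - y := by linear_combination hzx
  subst hzeq
  have hdev : ‖(s - s⁻¹) * y / 2‖ ≤ ‖s - s⁻¹‖ / 2 := by
    rw [norm_div, norm_mul, Complex.norm_ofNat]
    nlinarith [norm_nonneg y]
  have hu1 : (s * (2 * x - y) + s⁻¹ * y) / 2 - x = (s - 1) * x - (s - s⁻¹) * y / 2 := by ring
  have hv1 : (s⁻¹ * (2 * x - y) + s * y) / 2 - x = (s⁻¹ - 1) * x + (s - s⁻¹) * y / 2 := by ring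
  have hu2 : (s * (2 * x - y) + s⁻¹ * y) / 2 = s * x - (s - s⁻¹) * y / 2 := by ring
  have hv2 : (s⁻¹ * (2 * x - y) + s * y) / 2 = s⁻¹ * x + (s - s⁻¹) * y / 2 := by ring
  have hu3 : |‖(s * (2 * x - y) + s⁻¹ * y) / 2‖ - ‖s‖ * ‖x‖| ≤ B := by
    rw [← norm_mul]
    refine (abs_norm_sub_norm_le _ _).trans ?_
    rw [hu2, sub_sub_cancel_left, norm_neg]
    linarith
  have hv3 : |‖(s⁻¹ * (2 * x - y) + s * y) / 2‖ - ‖s⁻¹‖ * ‖x‖| ≤ B := by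
    rw [← norm_mul]
    refine (abs_norm_sub_norm_le _ _).trans ?_
    rw [hv2, add_sub_cancel_left]
    linarith
  refine ⟨_, _, hf, ?_, ⟨?_, ?_, hu3, ?_⟩, ⟨?_, ?_, hv3, ?_⟩⟩
  · have e : (s * (2 * x - y) + s⁻¹ * y) / 2 - (s⁻¹ * (2 * x - y) + s * y) / 2
        = (s - s⁻¹) * (x - y) := by ring
    rw [e, norm_mul]
    refine hxc.trans ?_
    gcongr
    have := norm_sub_norm_le x y
    linarith
  · rw [hu1]
    refine (norm_sub_le _ _).trans ?_
    rw [norm_mul]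
    linarith
  · have := (abs_le.1 hu3).2
    have h3 : ‖s‖ * ‖x‖ ≤ B * ‖x‖ := by
      gcongr; rw [hB]; linarith
    nlinarith
  · linear_combination (-(s - s⁻¹) ^ 2 / 4) * hzy - x ^ 2 * hss
  · rw [hv1]
    refine (norm_add_le _ _).trans ?_
    rw [norm_mul]
    linarith
  · have := (abs_le.1 hv3).2
    have h3 : ‖s⁻¹‖ * ‖x‖ ≤ B * ‖x‖ := by
      gcongr; rw [hB]; linarith [norm_nonneg s]
    nlinarith
  · linear_combination (-(s - s⁻¹) ^ 2 / 4) * hzy - x ^ 2 * hss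

/-! ### Exceptional radii and logarithmic measure -/

open MeasureTheory

/-- The measure `dt / t` on `[1, ∞)`. -/
noncomputable def logMeasure : Measure ℝ :=
  (volume.restrict (Set.Ici 1)).withDensity fun t => ENNReal.ofReal (1 / t)

lemma finiteLogMeasure_iff {E : Set ℝ} :
    FiniteLogMeasure E ↔ MeasurableSet E ∧ logMeasure E < ⊤ := by
  refine and_congr_right fun hE => ?_
  rw [logMeasure, withDensity_apply _ hE, Measure.restrict_restrict hE]

lemma FiniteLogMeasure.union {E F : Set ℝ} (hE : FiniteLogMeasure E) (hF : FiniteLogMeasure F) :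
    FiniteLogMeasure (E ∪ F) := by
  rw [finiteLogMeasure_iff] at *
  exact ⟨hE.1.union hF.1, (measure_union_le _ _).trans_lt (ENNReal.add_lt_top.2 ⟨hE.2, hF.2⟩)⟩

lemma finiteLogMeasure_of_countable {E : Set ℝ} (hE : E.Countable) : FiniteLogMeasure E := by
  refine ⟨hE.measurableSet, ?_⟩
  have h : volume (E ∩ Set.Ici 1) = 0 := (hE.mono Set.inter_subset_left).measure_zero _
  rw [setLIntegral_measure_zero _ _ h]
  exact ENNReal.zero_lt_top

lemma logMeasure_le {J : Set ℝ} {p q lo : ℝ} (hJ : MeasurableSet J) (hlo : 0 < lo)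
    (hJlo : ∀ r ∈ J, lo ≤ r) (hJpq : J ⊆ Set.Icc p q) :
    logMeasure J ≤ ENNReal.ofReal ((q - p) / lo) := by
  rw [logMeasure, withDensity_apply _ hJ, Measure.restrict_restrict hJ]
  calc ∫⁻ t in J ∩ Set.Ici 1, ENNReal.ofReal (1 / t)
      ≤ ∫⁻ _ in J ∩ Set.Ici 1, ENNReal.ofReal (1 / lo) := by
        refine setLIntegral_mono measurable_const fun t ht => ?_
        exact ENNReal.ofReal_le_ofReal (one_div_le_one_div_of_le hlo (hJlo t ht.1))
    _ = ENNReal.ofReal (1 / lo) * volume (J ∩ Set.Ici 1) := by rw [setLIntegral_const]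
    _ ≤ ENNReal.ofReal (1 / lo) * ENNReal.ofReal (q - p) := by
        gcongr
        rw [← Real.volume_Icc]
        exact measure_mono (Set.inter_subset_left.trans hJpq)
    _ = ENNReal.ofReal ((q - p) / lo) := by
        rw [← ENNReal.ofReal_mul (by positivity)]
        congr 1
        ring

lemma finiteLogMeasure_Iio (M : ℝ) : FiniteLogMeasure (Set.Iio M) := by
  refine ⟨measurableSet_Iio, ?_⟩
  have h1 : FiniteLogMeasure (Set.Ico 1 M) := by
    rw [finiteLogMeasure_iff]
    exact ⟨measurableSet_Ico, (logMeasure_le measurableSet_Ico one_pos (fun r hr => hr.1)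
      Set.Ico_subset_Icc_self).trans_lt ENNReal.ofReal_lt_top⟩
  refine lt_of_le_of_lt (lintegral_mono_set ?_) h1.2
  exact fun r hr => ⟨⟨hr.2, hr.1⟩, hr.2⟩

/-- The radii `r` for which `t r` is relatively close to a given radius `d`. -/
lemma logMeasure_near_le {t η d : ℝ} {J : Set ℝ} (ht : 0 < t) (hη : η ≤ t / 4) (hη0 : 0 ≤ η)
    (hJ : MeasurableSet J) (h : ∀ r ∈ J, 0 < r ∧ |t * r - d| ≤ 2 * r * η) :
    logMeasure J ≤ ENNReal.ofReal (12 * η / t) := by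
  by_cases hd : 0 < d
  · have key : ∀ r ∈ J, d ≤ 3 / 2 * (t * r) ∧ t * r ≤ 2 * d ∧ |t * r - d| ≤ 4 * d * η / t := by
      intro r hr
      obtain ⟨h0, h1⟩ := h r hr
      have h2 : 2 * r * η ≤ t * r / 2 := by nlinarith
      have h3 := abs_le.1 (h1.trans h2)
      have h4 : t * r ≤ 2 * d := by linarith
      refine ⟨by linarith, h4, h1.trans ?_⟩
      rw [le_div_iff₀ ht]
      nlinarith
    -- The radii lie in an interval of length `8 d η / t ^ 2` on which `r ≥ 2 d / (3 t)`; the ratio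
    -- is `12 η / t`.
    have hm := logMeasure_le (p := d / t - 4 * d * η / t / t) (q := d / t + 4 * d * η / t / t)
      (lo := 2 / 3 * d / t) hJ (by positivity)
      (fun r hr => by
        rw [div_le_iff₀ ht]
        linarith [(key r hr).1])
      (fun r hr => by
        have h3 := abs_le.1 (key r hr).2.2
        rw [Set.mem_Icc, ← sub_div, ← add_div, div_le_iff₀ ht, le_div_iff₀ ht]
        constructor <;> linarith)
    refine hm.trans (ENNReal.ofReal_le_ofReal (le_of_eq ?_))
    field_simp
    ring
  · have : J = ∅ := by
      refine Set.eq_empty_of_forall_notMem fun r hr => ?_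
      obtain ⟨h0, h1⟩ := h r hr
      have h3 := (abs_le.1 h1).2
      nlinarith [mul_pos ht h0]
    simp [this]

/-- If a set `S` of points has counting function `O((log ρ) ^ β)`, then the radii `r` for which
`t r` comes within `2 r / (log (r + 3)) ^ σ` of the modulus of a point of `S` have finite
logarithmic measure, provided that `β < σ`. -/
theorem finiteLogMeasure_near {S : Set ℂ} {β σ C t ρ₀ : ℝ} (hS : S.Countable) (hβ : 0 ≤ β)
    (hβσ : β < σ) (ht : 0 < t) (hC : 0 ≤ C)
    (hcard : ∀ ρ, ρ₀ ≤ ρ → ∃ F : Finset ℂ, (∀ c ∈ S, ‖c‖ < ρ → c ∈ F) ∧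
      (F.card : ℝ) ≤ C * Real.log ρ ^ β) :
    ∃ M : ℝ, FiniteLogMeasure {r : ℝ | M ≤ r ∧
      ∃ c ∈ S, |t * r - ‖c‖| < 2 * (r / Real.log (r + 3) ^ σ)} := by
  have hσ : 0 < σ := hβ.trans_lt hβσ
  have hpow : Tendsto (fun j : ℕ => (2 : ℝ) ^ j) atTop atTop :=
    tendsto_pow_atTop_atTop_of_one_lt one_lt_two
  have hexp : Tendsto (fun j : ℕ => 2 * t * Real.exp (2 ^ (j + 1))) atTop atTop :=
    (Real.tendsto_exp_atTop.comp (hpow.comp (tendsto_add_atTop_nat 1))).const_mul_atTop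
      (by positivity)
  have hη : Tendsto (fun j : ℕ => (((2 : ℝ) ^ j) ^ σ)⁻¹) atTop (𝓝 0) :=
    ((tendsto_rpow_atTop hσ).comp hpow).inv_tendsto_atTop
  obtain ⟨j₀, hj₀⟩ := eventually_atTop.1 ((hexp.eventually_ge_atTop (max ρ₀ 1)).and
    ((hη.eventually (eventually_le_nhds (show (0 : ℝ) < t / 4 by positivity))).and
      (hpow.eventually_ge_atTop (Real.log (2 * t)))))
  -- Blocks dyadic in `log r`: on block `j` the relative width is at most of order `η = 2 ^ (-j σ)`,
  -- and `O(2 ^ (j β))` points matter, so the total is a geometric series of ratio `2 ^ (β - σ)`.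
  set E : ℕ → Set ℝ := fun j => {r : ℝ | (Real.exp (2 ^ j) ≤ r ∧ r < Real.exp (2 ^ (j + 1))) ∧
      ∃ c ∈ S, |t * r - ‖c‖| < 2 * (r / Real.log (r + 3) ^ σ)} with hE
  have hmeas1 : ∀ c : ℂ, MeasurableSet
      {r : ℝ | |t * r - ‖c‖| < 2 * (r / Real.log (r + 3) ^ σ)} := fun c =>
    measurableSet_lt (by fun_prop) (by fun_prop)
  have hmeas : MeasurableSet
      {r : ℝ | ∃ c ∈ S, |t * r - ‖c‖| < 2 * (r / Real.log (r + 3) ^ σ)} := by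
    have : {r : ℝ | ∃ c ∈ S, |t * r - ‖c‖| < 2 * (r / Real.log (r + 3) ^ σ)}
        = ⋃ c ∈ S, {r : ℝ | |t * r - ‖c‖| < 2 * (r / Real.log (r + 3) ^ σ)} := by
      ext r; simp
    rw [this]
    exact MeasurableSet.biUnion hS fun c _ => hmeas1 c
  have hEj : ∀ j, j₀ ≤ j → logMeasure (E j) ≤
      ENNReal.ofReal (C * 4 ^ β * (12 / t) * ((2 : ℝ) ^ (β - σ)) ^ j) := by
    intro j hj
    obtain ⟨h1, h2, h3⟩ := hj₀ j hj
    obtain ⟨F, hF, hFc⟩ := hcard _ ((le_max_left _ _).trans h1)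
    set η := (((2 : ℝ) ^ j) ^ σ)⁻¹ with hηdef
    have hη0 : 0 ≤ η := by positivity
    have hbound : ∀ r : ℝ, Real.exp (2 ^ j) ≤ r → r / Real.log (r + 3) ^ σ ≤ r * η := by
      intro r hr
      have hr0 : 0 < r := (Real.exp_pos _).trans_le hr
      have hl : (2 : ℝ) ^ j ≤ Real.log (r + 3) := by
        rw [Real.le_log_iff_exp_le (by linarith)]
        linarith
      rw [div_eq_mul_inv, hηdef]
      gcongr
    set J : ℂ → Set ℝ := fun c => {r : ℝ | (Real.exp (2 ^ j) ≤ r ∧ r < Real.exp (2 ^ (j + 1))) ∧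
      |t * r - ‖c‖| < 2 * (r / Real.log (r + 3) ^ σ)} with hJ
    have hsub : E j ⊆ ⋃ c ∈ F, J c := by
      rintro r ⟨hr, c, hcS, hc⟩
      refine Set.mem_biUnion (hF c hcS ?_) ⟨hr, hc⟩
      have hr0 : 0 < r := (Real.exp_pos _).trans_le hr.1
      have h4 := hbound r hr.1
      -- Since `η ≤ t / 4`, a point close to `t r` has modulus below `2 t r`, hence is counted by
      -- `F`.
      have h5 : r * η ≤ r * (t / 4) := by gcongr
      have h6 := (abs_lt.1 hc).1
      nlinarith [mul_lt_mul_of_pos_left hr.2 ht]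
    have hJc : ∀ c ∈ F, logMeasure (J c) ≤ ENNReal.ofReal (12 * η / t) := by
      intro c _
      refine logMeasure_near_le (d := ‖c‖) ht h2 hη0 (measurableSet_Ico.inter (hmeas1 c)) ?_
      rintro r ⟨hr, hc⟩
      refine ⟨(Real.exp_pos _).trans_le hr.1, hc.le.trans ?_⟩
      linarith [hbound r hr.1]
    calc logMeasure (E j) ≤ logMeasure (⋃ c ∈ F, J c) := measure_mono hsub
      _ ≤ ∑ c ∈ F, logMeasure (J c) := measure_biUnion_finset_le _ _
      _ ≤ ∑ _c ∈ F, ENNReal.ofReal (12 * η / t) := Finset.sum_le_sum hJc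
      _ = ENNReal.ofReal (F.card * (12 * η / t)) := by
          rw [Finset.sum_const, nsmul_eq_mul, ENNReal.ofReal_mul (by positivity),
            ENNReal.ofReal_natCast]
      _ ≤ _ := by
          refine ENNReal.ofReal_le_ofReal ?_
          have hlog : Real.log (2 * t * Real.exp (2 ^ (j + 1))) ≤ 4 * 2 ^ j := by
            rw [Real.log_mul (by positivity) (by positivity), Real.log_exp, pow_succ]
            linarith [pow_pos (two_pos (α := ℝ)) j]
          have hexpand : ((2 : ℝ) ^ (β - σ)) ^ j = ((2 : ℝ) ^ j) ^ β * η := by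
            rw [hηdef, ← Real.rpow_neg (by positivity), ← Real.rpow_add (by positivity),
              ← Real.rpow_natCast, ← Real.rpow_natCast, ← Real.rpow_mul two_pos.le,
              ← Real.rpow_mul two_pos.le, mul_comm, sub_eq_add_neg]
          have hlog0 : Real.log (2 * t * Real.exp (2 ^ (j + 1))) ^ β ≤ (4 * 2 ^ j) ^ β := by
            exact Real.rpow_le_rpow (Real.log_nonneg ((le_max_right _ _).trans h1)) hlog hβ
          rw [hexpand]
          calc (F.card : ℝ) * (12 * η / t) ≤ (C * (4 * 2 ^ j) ^ β) * (12 * η / t) := by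
                gcongr
                exact hFc.trans (by gcongr)
            _ = _ := by
                rw [Real.mul_rpow (by norm_num) (by positivity)]
                ring
  refine ⟨Real.exp (2 ^ j₀), finiteLogMeasure_iff.2 ⟨measurableSet_Ici.inter hmeas, ?_⟩⟩
  have hcover : {r : ℝ | Real.exp (2 ^ j₀) ≤ r ∧
      ∃ c ∈ S, |t * r - ‖c‖| < 2 * (r / Real.log (r + 3) ^ σ)} ⊆ ⋃ i : ℕ, E (i + j₀) := by
    rintro r ⟨hr, hc⟩
    have hr0 : 0 < r := (Real.exp_pos _).trans_le hr
    have hl : (2 : ℝ) ^ j₀ ≤ Real.log r := by rwa [Real.le_log_iff_exp_le hr0]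
    have hl1 : 1 ≤ Real.log r := (one_le_pow₀ one_le_two).trans hl
    obtain ⟨n, hn1, hn2⟩ := exists_nat_pow_near hl1 one_lt_two
    have hjn : j₀ ≤ n := by
      have : (2 : ℝ) ^ j₀ < 2 ^ (n + 1) := hl.trans_lt hn2
      exact Nat.lt_succ_iff.1 ((pow_lt_pow_iff_right₀ one_lt_two).1 this)
    refine Set.mem_iUnion.2 ⟨n - j₀, ⟨?_, ?_⟩, hc⟩
    · rw [Nat.sub_add_cancel hjn, ← Real.le_log_iff_exp_le hr0]
      exact hn1
    · rw [Nat.sub_add_cancel hjn, ← Real.log_lt_iff_lt_exp hr0]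
      exact hn2
  have hlt : (2 : ℝ) ^ (β - σ) < 1 := Real.rpow_lt_one_of_one_lt_of_neg one_lt_two (by linarith)
  have hsum : Summable fun i : ℕ =>
      C * 4 ^ β * (12 / t) * ((2 : ℝ) ^ (β - σ)) ^ (i + j₀) := by
    refine Summable.mul_left _ ?_
    exact (summable_nat_add_iff j₀).2 (summable_geometric_of_lt_one (by positivity) hlt)
  calc _ ≤ logMeasure (⋃ i : ℕ, E (i + j₀)) := measure_mono hcover
    _ ≤ ∑' i : ℕ, logMeasure (E (i + j₀)) := measure_iUnion_le _
    _ ≤ ∑' i : ℕ, ENNReal.ofReal (C * 4 ^ β * (12 / t) * ((2 : ℝ) ^ (β - σ)) ^ (i + j₀)) :=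
        ENNReal.tsum_le_tsum fun i => hEj _ (Nat.le_add_left _ _)
    _ = ENNReal.ofReal (∑' i : ℕ, C * 4 ^ β * (12 / t) * ((2 : ℝ) ^ (β - σ)) ^ (i + j₀)) :=
        (ENNReal.ofReal_tsum_of_nonneg (fun i => by positivity) hsum).symm
    _ < ⊤ := ENNReal.ofReal_lt_top

/-! ### Growth of proximity and counting functions -/

open ValueDistribution

lemma characteristic_le_of_logOrder {f : ℂ → ℂ} {σ ε : ℝ} (hσ : logOrder f = (σ : EReal))
    (hε : 0 < ε) : ∀ᶠ r in atTop, characteristic f ⊤ r ≤ Real.log r ^ (σ + ε) := by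
  have h : logOrder f < ((σ + ε : ℝ) : EReal) := by
    rw [hσ]; exact_mod_cast (lt_add_of_pos_right σ hε)
  have hll : ∀ᶠ r in atTop, 1 < Real.log r :=
    Real.tendsto_log_atTop.eventually_gt_atTop 1
  filter_upwards [eventually_lt_of_limsup_lt h, hll] with r hr hl
  have hr' := EReal.coe_lt_coe_iff.1 hr
  rw [div_lt_iff₀ (Real.log_pos hl)] at hr'
  -- `Real.log` of a nonpositive number carries no upper bound on it, so this case is separate.
  rcases le_or_gt (characteristic f ⊤ r) 0 with h0 | h0
  · exact h0.trans (by positivity)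
  · rw [Real.rpow_def_of_pos (by linarith), ← Real.log_le_iff_le_exp h0]
    linarith

-- A pole `z` with `|z| < r` contributes at least `log (r ^ 2 / |z|) ≥ log r` to `N(r ^ 2, f)`. This
-- gains the power of `log r` by which counting functions beat the characteristic.
open Function.locallyFinsuppWithin in
lemma poleCount_mul_log_le (f : ℂ → ℂ) {r : ℝ} (hr : 1 ≤ r) :
    poleCount f r * Real.log r ≤ logCounting f ⊤ (r ^ 2) := by
  classical
  set D := (MeromorphicOn.divisor f Set.univ)⁻ with hD
  have hD0 : ∀ z, 0 ≤ D z := fun z => by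
    rw [hD, Function.locallyFinsuppWithin.negPart_apply]; exact negPart_nonneg _
  have hfin : (Metric.closedBall (0 : ℂ) r ∩ Function.support D).Finite :=
    (Function.locallyFinsupp.locallyFiniteSupport D).finite_inter_support_of_isCompact
      (isCompact_closedBall 0 r)
  have hfin' : (Metric.ball (0 : ℂ) r ∩ Function.support D).Finite :=
    hfin.subset (Set.inter_subset_inter_left _ Metric.ball_subset_closedBall)
  set F := hfin'.toFinset with hF
  have hle : ∑ z ∈ F, single z (D z) ≤ D := by
    intro y
    simp only [coe_sum, Finset.sum_apply, single_apply]
    rw [Finset.sum_ite_eq]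
    split_ifs
    · exact le_rfl
    · exact hD0 y
  have hr2 : 1 ≤ r ^ 2 := one_le_pow₀ hr
  have h1 := logCounting_le hle hr2
  have hFr : ∀ z ∈ F, ‖z‖ < r := fun z hz => by
    have := (hfin'.mem_toFinset.1 hz).1
    simpa using this
  rw [map_sum, Finset.sum_apply] at h1
  rw [logCounting_top, poleCount, finsum_mem_eq_sum_of_inter_support_eq (t := F)]
  · refine le_trans ?_ h1
    push_cast
    rw [Finset.sum_mul]
    refine Finset.sum_le_sum fun z hz => ?_
    have hz1 := hFr z hz
    rw [logCounting_single_eq_log_sub_const (by nlinarith [norm_nonneg z])]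
    refine mul_le_mul_of_nonneg_left ?_ (by exact_mod_cast hD0 z)
    have hlr := Real.log_nonneg hr
    rw [Real.log_pow]
    -- A pole at the origin contributes `log (r ^ 2)`, in agreement with the default `Real.log 0 =
    -- 0`.
    rcases (norm_nonneg z).eq_or_lt with h0 | h0
    · rw [← h0, Real.log_zero]; push_cast; linarith
    · have := Real.log_le_log h0 hz1.le
      push_cast; linarith
  · ext z
    simp only [hF, Set.Finite.coe_toFinset]
    simp only [Set.mem_inter_iff]
    tauto

lemma poleCount_nonneg (f : ℂ → ℂ) (r : ℝ) : 0 ≤ poleCount f r := by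
  rw [poleCount]
  exact_mod_cast finsum_nonneg fun z => finsum_nonneg fun _ => negPart_nonneg _

/-- By Jensen's formula `T(r, 1/f)` differs from `T(r, f)` by at most a constant `K`, absorbed
because the power of `log r` is at least one. The counting bound comes from radius `r ^ 2`, which
costs the factor `2 ^ (σ + ε)`. -/
lemma exists_growth_bound {f : ℂ → ℂ} {σ ε : ℝ} (hf : Meromorphic f)
    (hσ : logOrder f = (σ : EReal)) (hσ1 : 1 ≤ σ) (hε : 0 < ε) :
    ∃ C r₀ : ℝ, 0 ≤ C ∧ ∀ r, r₀ ≤ r →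
      proximity f ⊤ r + proximity f⁻¹ ⊤ r ≤ C * Real.log r ^ (σ + ε) ∧
      poleCount f r + poleCount f⁻¹ r ≤ C * Real.log r ^ (σ - 1 + ε) := by
  obtain ⟨r₁, hr₁⟩ := eventually_atTop.1 (characteristic_le_of_logOrder hσ hε)
  set K := max |Real.log ‖f 0‖| |Real.log ‖meromorphicTrailingCoeffAt f 0‖| with hK
  have hK0 : 0 ≤ K := (abs_nonneg _).trans (le_max_left _ _)
  have hsum : ∀ r, r₁ ≤ r → Real.exp 1 ≤ r →
      characteristic f ⊤ r + characteristic f⁻¹ ⊤ r ≤ (2 + K) * Real.log r ^ (σ + ε) := by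
    intro r h1 h2
    have h3 := hr₁ r h1
    have h4 := (abs_le.1 (characteristic_sub_characteristic_inv_le (R := r) hf)).1
    rw [← hK] at h4
    have hl : 1 ≤ Real.log r := by
      rwa [Real.le_log_iff_exp_le ((Real.exp_pos 1).trans_le h2)]
    have h5 : 1 ≤ Real.log r ^ (σ + ε) := Real.one_le_rpow hl (by linarith)
    nlinarith
  refine ⟨(2 + K) * 2 ^ (σ + ε), max r₁ (Real.exp 1), by positivity, fun r hr => ?_⟩
  have hr1 : r₁ ≤ r := (le_max_left _ _).trans hr
  have hre : Real.exp 1 ≤ r := (le_max_right _ _).trans hr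
  have hr0 : 1 ≤ r := by
    have := Real.add_one_le_exp (1 : ℝ)
    linarith
  have hl : 1 ≤ Real.log r := by
    rwa [Real.le_log_iff_exp_le ((Real.exp_pos 1).trans_le hre)]
  have hlp : 0 ≤ Real.log r ^ (σ + ε) := by positivity
  have hrr : r ≤ r ^ 2 := by nlinarith
  constructor
  · have h1 := hsum r hr1 hre
    have h2 := logCounting_nonneg (f := f) (e := ⊤) hr0
    have h3 := logCounting_nonneg (f := f⁻¹) (e := ⊤) hr0
    simp only [characteristic, Pi.add_apply] at h1
    have h4 : (1 : ℝ) ≤ 2 ^ (σ + ε) := Real.one_le_rpow one_le_two (by linarith)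
    have h5 : (2 + K) * Real.log r ^ (σ + ε) ≤ (2 + K) * Real.log r ^ (σ + ε) * 2 ^ (σ + ε) :=
      le_mul_of_one_le_right (by positivity) h4
    linarith
  · have h1 := hsum (r ^ 2) (hr1.trans hrr) (hre.trans hrr)
    have h2 := proximity_nonneg (f := f) (a := ⊤) (r ^ 2)
    have h3 := proximity_nonneg (f := f⁻¹) (a := ⊤) (r ^ 2)
    simp only [Pi.zero_apply] at h2 h3
    simp only [characteristic, Pi.add_apply] at h1
    have h4 := poleCount_mul_log_le f hr0
    have h5 := poleCount_mul_log_le f⁻¹ hr0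
    rw [Real.log_pow, Real.mul_rpow (by norm_num) (by linarith)] at h1
    have h6 : (poleCount f r + poleCount f⁻¹ r) * Real.log r ≤
        (2 + K) * 2 ^ (σ + ε) * Real.log r ^ (σ - 1 + ε) * Real.log r := by
      have e : Real.log r ^ (σ + ε) = Real.log r ^ (σ - 1 + ε) * Real.log r := by
        rw [← Real.rpow_add_one (by linarith)]; congr 1; ring
      rw [e] at h1
      push_cast at h1
      nlinarith
    exact le_of_mul_le_mul_right h6 (by linarith)

open Function.locallyFinsuppWithin in
/-- A meromorphic function which is not constant has logarithmic order at least one. -/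
theorem one_le_of_logOrder {f : ℂ → ℂ} {σ : ℝ} (hf : Meromorphic f)
    (hσ : logOrder f = (σ : EReal)) (hconst : ¬ ∃ a : ℂ, f =ᶠ[codiscrete ℂ] fun _ => a) :
    1 ≤ σ := by
  classical
  obtain ⟨p, hp⟩ : ∃ p, AnalyticAt ℂ f p := by
    by_contra! h
    refine not_countable_complex (hf.countable_compl_analyticAt.mono fun z _ => ?_)
    exact h z
  have hg : Meromorphic (fun z => f z - f p) := fun z => (hf z).sub (MeromorphicAt.const _ _)
  have hgan : AnalyticAt ℂ (fun z => f z - f p) p := hp.sub analyticAt_const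
  have hgp : meromorphicOrderAt (fun z => f z - f p) p ≠ ⊤ := by
    intro htop
    refine hconst ⟨f p, ?_⟩
    have hall : ∀ z, meromorphicOrderAt (fun z => f z - f p) z = ⊤ := by
      intro z
      by_contra hz
      exact hg.exists_meromorphicOrderAt_ne_top_iff_forall.1 ⟨z, hz⟩ p htop
    rw [EventuallyEq, eventually_iff, mem_codiscrete]
    intro z
    rw [disjoint_principal_right, compl_compl]
    filter_upwards [meromorphicOrderAt_eq_top_iff.1 (hall z)] with w hw
    exact sub_eq_zero.1 hw
  have hpos : 1 ≤ MeromorphicOn.divisor (fun z => f z - f p) Set.univ p := by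
    rw [hg.meromorphicOn.divisor_apply (Set.mem_univ p)]
    have h1 : meromorphicOrderAt (fun z => f z - f p) p ≠ 0 := by
      rw [ne_eq, hgan.meromorphicNFAt.meromorphicOrderAt_eq_zero_iff]
      simp
    have h2 := hgan.meromorphicOrderAt_nonneg
    lift meromorphicOrderAt (fun z => f z - f p) p to ℤ using hgp with n hn
    rw [WithTop.untop₀_coe]
    have h3 : (0 : ℤ) ≤ n := by exact_mod_cast h2
    have h4 : n ≠ 0 := by exact_mod_cast h1
    omega
  have hle : single p (1 : ℤ) ≤ (MeromorphicOn.divisor (fun z => f z - f p) Set.univ)⁺ := by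
    intro y
    rw [Function.locallyFinsuppWithin.posPart_apply, single_apply]
    split_ifs with h
    · subst h
      exact hpos.trans (le_posPart _)
    · exact posPart_nonneg _
  -- One genuine zero of `f - f p` at `p` already forces `T(r, f) ≥ log r - K`, by the first main
  -- theorem.
  obtain ⟨K, hK⟩ : ∃ K : ℝ, ∀ r, max 1 ‖p‖ ≤ r → Real.log r - K ≤ characteristic f ⊤ r := by
    refine ⟨Real.log ‖p‖ + max |Real.log ‖f 0 - f p‖|
      |Real.log ‖meromorphicTrailingCoeffAt (fun z => f z - f p) 0‖| +
      (Real.posLog ‖f p‖ + Real.log 2), fun r hr => ?_⟩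
    have hr1 : 1 ≤ r := (le_max_left _ _).trans hr
    have h1 := logCounting_le hle hr1
    rw [logCounting_single_eq_log_sub_const ((le_max_right _ _).trans hr), ← logCounting_coe] at h1
    have h2 := (abs_le.1 (characteristic_sub_characteristic_inv_le (R := r) hg)).1
    have h3 := (abs_le.1 (abs_characteristic_sub_characteristic_shift_le (a₀ := f p) (r := r) hf)).1
    have h4 := proximity_nonneg (f := (fun z => f z - f p)⁻¹) (a := ⊤) r
    have h5 : characteristic (fun z => f z - f p)⁻¹ ⊤ r =
        proximity (fun z => f z - f p)⁻¹ ⊤ r + logCounting f (f p) r := by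
      rw [characteristic, Pi.add_apply, logCounting_inv, logCounting_coe_eq_logCounting_sub_const_zero]
      rfl
    simp only [Pi.zero_apply, Int.cast_one, one_mul] at h1 h4
    linarith
  by_contra! hlt
  -- If `σ < 1`, then `T(r, f) ≤ (log r) ^ ((1 + σ) / 2)` eventually, an exponent below one.
  have hε : 0 < (1 - σ) / 2 := by linarith
  have hlog := Real.tendsto_log_atTop
  have h6 : ∀ᶠ y : ℝ in atTop, y ^ (-((1 - σ) / 2)) ≤ 1 / 2 :=
    (tendsto_rpow_neg_atTop hε).eventually (eventually_le_nhds (by norm_num))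
  have h7 := hlog.eventually h6
  obtain ⟨r, hr1, hr2, hr3, hr4⟩ := ((characteristic_le_of_logOrder hσ hε).and (h7.and
    ((eventually_ge_atTop (max 1 ‖p‖)).and (hlog.eventually_gt_atTop (max 0 (2 * K)))))).exists
  have hr5 : 0 < Real.log r := (le_max_left _ _).trans_lt hr4
  have hr6 : 2 * K < Real.log r := (le_max_right _ _).trans_lt hr4
  have e : Real.log r ^ (σ + (1 - σ) / 2) = Real.log r ^ (-((1 - σ) / 2)) * Real.log r := by
    rw [← Real.rpow_add_one hr5.ne']
    congr 1
    ring
  rw [e] at hr1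
  nlinarith [hK r hr3]

/-! ### The pointwise estimate outside the exceptional set -/

/-- The number of distinct zeros and poles in a disk is at most their number with multiplicity. -/
lemma exists_finset_card_le {f : ℂ → ℂ} (hf : Meromorphic f) (ρ : ℝ) :
    ∃ F : Finset ℂ, (∀ c ∈ Function.support (MeromorphicOn.divisor f Set.univ), ‖c‖ < ρ → c ∈ F) ∧
      (F.card : ℝ) ≤ poleCount f ρ + poleCount f⁻¹ ρ := by
  have hfin : (MeromorphicOn.divisor f (Metric.ball 0 ρ)).support.Finite :=
    (hf.meromorphicOn (s := Metric.closedBall 0 ρ)).divisor_ball_support_finite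
  refine ⟨hfin.toFinset, fun c hc hcρ => ?_, ?_⟩
  · have hcb : c ∈ Metric.ball (0 : ℂ) ρ := by simpa using hcρ
    rw [Set.Finite.mem_toFinset, Function.mem_support, hf.meromorphicOn.divisor_apply hcb,
      ← hf.meromorphicOn.divisor_apply (Set.mem_univ c)]
    exact hc
  · rw [poleCount_eq_finsum hf, finsum_eq_sum_of_support_subset (s := hfin.toFinset) _
      (fun i hi => by simpa using hi), Finset.card_eq_sum_ones, Nat.cast_sum]
    refine Finset.sum_le_sum fun i hi => ?_
    have h : MeromorphicOn.divisor f (Metric.ball 0 ρ) i ≠ 0 := by simpa using hi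
    rw [← Int.cast_abs]
    exact_mod_cast Int.one_le_abs h

lemma countable_compl_of_mem_codiscrete {s : Set ℂ} (hs : s ∈ codiscrete ℂ) : sᶜ.Countable := by
  have h : IsDiscrete (sᶜ ∩ Set.univ) := isDiscrete_of_codiscreteWithin (by rw [compl_compl]; exact hs)
  simpa using (HereditarilyLindelofSpace.isLindelof (sᶜ ∩ Set.univ)).countable_of_isDiscrete h

/-- The points algebraically related to a countable set have countably many moduli. -/
lemma countable_norm_related (s : ℂ) {B : Set ℂ} (hB : B.Countable) :
    ((fun x : ℂ => ‖x‖) '' {x | x ∈ B ∨ ∃ b ∈ B,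
      x ^ 2 - (s + s⁻¹) * b * x + (b ^ 2 + ((s - s⁻¹) / 2) ^ 2) = 0}).Countable := by
  refine Set.Countable.image ?_ _
  have h : {x | x ∈ B ∨ ∃ b ∈ B,
      x ^ 2 - (s + s⁻¹) * b * x + (b ^ 2 + ((s - s⁻¹) / 2) ^ 2) = 0} = B ∪ ⋃ b ∈ B,
      {x | x ^ 2 - (s + s⁻¹) * b * x + (b ^ 2 + ((s - s⁻¹) / 2) ^ 2) = 0} := by
    ext x; simp
  rw [h]
  refine hB.union (hB.biUnion fun b _ => ?_)
  rcases Set.eq_empty_or_nonempty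
    {x | x ^ 2 - (s + s⁻¹) * b * x + (b ^ 2 + ((s - s⁻¹) / 2) ^ 2) = 0} with h0 | ⟨y, hy⟩
  · rw [h0]; exact Set.countable_empty
  -- By Vieta, a quadratic with root `y` has second root `(s + s⁻¹) b - y`.
  · refine (Set.toFinite {y, (s + s⁻¹) * b - y}).countable.mono fun x hx => ?_
    have hxy : (x - y) * (x - ((s + s⁻¹) * b - y)) = 0 := by
      simp only [Set.mem_ofPred_eq] at hx hy
      linear_combination hx - hy
    rcases mul_eq_zero.1 hxy with h1 | h1
    · exact Or.inl (sub_eq_zero.1 h1)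
    · exact Or.inr (sub_eq_zero.1 h1)

/-- The Askey-Wilson operator annihilates almost constant functions, up to small exceptional
sets of radii. -/
lemma exists_awOp_eq_zero {s : ℂ} (hs0 : s ≠ 0) (hs1 : ‖s‖ < 1) {f : ℂ → ℂ} {a : ℂ}
    (hf : f =ᶠ[codiscrete ℂ] fun _ => a) :
    ∃ E : Set ℝ, FiniteLogMeasure E ∧ ∀ x : ℂ, ‖x‖ ∉ E → awOp s f x = 0 := by
  obtain ⟨r₀, -, hr₀⟩ := exists_awOp_points hs0 hs1
  have hB : ({z | f z = a}ᶜ : Set ℂ).Countable := countable_compl_of_mem_codiscrete hf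
  refine ⟨_, (finiteLogMeasure_Iio r₀).union (finiteLogMeasure_of_countable
    (countable_norm_related s hB)), fun x hx => ?_⟩
  rw [Set.mem_union, not_or, Set.mem_Iio, not_lt] at hx
  obtain ⟨u, v, hD, -, ⟨-, -, -, hu⟩, ⟨-, -, -, hv⟩⟩ := hr₀ x hx.1
  have hgood : ∀ w, x ^ 2 - (s + s⁻¹) * w * x + (w ^ 2 + ((s - s⁻¹) / 2) ^ 2) = 0 → f w = a := by
    intro w hw
    by_contra hne
    exact hx.2 ⟨x, Or.inr ⟨w, hne, hw⟩, rfl⟩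
  rw [hD, hgood u hu, hgood v hv, sub_self, zero_div]

/-- The estimate for one of the two shifted points. -/
lemma posLog_norm_div_le_of_near {f : ℂ → ℂ} {R α A κ L : ℝ} {x w : ℂ} (hf : Meromorphic f)
    (hord : ∀ z, meromorphicOrderAt f z ≠ ⊤) (hA : 0 ≤ A) (hκ : 1 ≤ κ) (hL : 0 ≤ L)
    (hR : κ * ‖x‖ < R) (hwx : ‖w - x‖ ≤ A * ‖x‖) (hw : ‖w‖ ≤ κ * ‖x‖)
    (hfx : AnalyticAt ℂ f x) (hfx0 : f x ≠ 0) (hfw : AnalyticAt ℂ f w) (hfw0 : f w ≠ 0)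
    (hα : 0 < α) (hα1 : α < 1)
    (hdx : ∀ i, MeromorphicOn.divisor f Set.univ i ≠ 0 → ‖x‖ ≤ L * ‖x - i‖)
    (hdw : ∀ i, MeromorphicOn.divisor f Set.univ i ≠ 0 → ‖x‖ ≤ L * ‖w - i‖) :
    Real.posLog ‖f w / f x‖ ≤
      2 * R * A * ‖x‖ / ((R - ‖x‖) * (R - κ * ‖x‖)) * (proximity f ⊤ R + proximity f⁻¹ ⊤ R)
      + (A * ‖x‖ * (1 / (R - ‖x‖) + 1 / (R - κ * ‖x‖)) + A ^ α * L ^ α / α) *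
        (poleCount f R + poleCount f⁻¹ R) := by
  have hxκ : ‖x‖ ≤ κ * ‖x‖ := le_mul_of_one_le_left (norm_nonneg x) hκ
  have hδ : ∀ t : ℝ, ‖x‖ ≤ L * t → ‖w - x‖ ≤ A * L * t := fun t ht => by
    rw [mul_assoc]; exact hwx.trans (by gcongr)
  have h := posLog_norm_div_le (δ := A * L) hf hord (hxκ.trans_lt hR) (hw.trans_lt hR) hfx hfx0 hfw
    hfw0 hα hα1 (by positivity) (fun i hi => hδ _ (hdx i hi)) (fun i hi => hδ _ (hdw i hi))
  have hM1 := proximity_nonneg (f := f) (a := ⊤) R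
  have hM2 := proximity_nonneg (f := f⁻¹) (a := ⊤) R
  have hN1 := poleCount_nonneg f R
  have hN2 := poleCount_nonneg f⁻¹ R
  simp only [Pi.zero_apply] at hM1 hM2
  have hR0 : 0 < R := (norm_nonneg x).trans_lt (hxκ.trans_lt hR)
  have h1 : 0 < R - ‖x‖ := by linarith
  have h2 : 0 < R - κ * ‖x‖ := by linarith
  have h3 : 0 < R - ‖w‖ := by linarith
  rw [Real.mul_rpow hA hL] at h
  refine h.trans ?_
  rw [mul_assoc (2 * R) A]
  gcongr

/-- Applied with `K = |s| + |s⁻¹|`, the error in replacing `|u|` by `|s| |x|` and `|v|` by `|s⁻¹|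
|x|`: it then uses up at most half of the gap `2 r / (log (r + 3)) ^ σ`. -/
lemma exists_log_rpow_le (σ K : ℝ) : ∃ M : ℝ, 1 ≤ M ∧ ∀ r, M ≤ r →
    K ≤ r / Real.log (r + 3) ^ σ ∧ 1 ≤ Real.log (r + 3) := by
  have h := isLittleO_log_rpow_rpow_atTop (s := 1) σ one_pos
  have hadd : Tendsto (fun r : ℝ => r + 3) atTop atTop := tendsto_atTop_add_const_right _ _ tendsto_id
  have h1 := hadd.eventually (h.bound (show (0 : ℝ) < 1 / (4 * (|K| + 1)) by positivity))
  have h2 := hadd.eventually (Real.tendsto_log_atTop.eventually_ge_atTop 1)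
  obtain ⟨M, hM⟩ := eventually_atTop.1 (h1.and h2)
  refine ⟨max M 1, le_max_right _ _, fun r hr => ?_⟩
  obtain ⟨h3, h4⟩ := hM r ((le_max_left _ _).trans hr)
  have hr1 : 1 ≤ r := (le_max_right _ _).trans hr
  have hL : 0 < Real.log (r + 3) ^ σ := Real.rpow_pos_of_pos (by linarith) σ
  refine ⟨?_, h4⟩
  rw [Real.norm_of_nonneg hL.le, Real.rpow_one, Real.norm_of_nonneg (by linarith),
    div_mul_eq_mul_div, one_mul, le_div_iff₀ (by positivity)] at h3
  rw [le_div_iff₀ hL]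
  nlinarith [le_abs_self K, abs_nonneg K]

/-- The pointwise estimate outside an exceptional set which does not depend on `α` and `R`. -/
theorem exists_exceptional_set {s : ℂ} (hs0 : s ≠ 0) (hs1 : ‖s‖ < 1) {f : ℂ → ℂ} {σ : ℝ}
    (hf : Meromorphic f) (hσ : logOrder f = (σ : EReal))
    (hconst : ¬ ∃ a : ℂ, f =ᶠ[codiscrete ℂ] fun _ => a) :
    ∃ E : Set ℝ, FiniteLogMeasure E ∧ ∀ α : ℝ, 0 < α → α < 1 → ∀ (x : ℂ) (R : ℝ), ‖x‖ ∉ E →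
      2 * (‖s‖ + ‖s⁻¹‖) * ‖x‖ < R →
      Real.posLog ‖awOp s f x / f x‖ ≤
        4 * R * (‖s - 1‖ + ‖s⁻¹ - 1‖) * ‖x‖ /
            ((R - ‖x‖) * (R - 2 * (‖s‖ + ‖s⁻¹‖) * ‖x‖)) *
          (proximity f ⊤ R + proximity f⁻¹ ⊤ R)
        + 2 * (‖s - 1‖ + ‖s⁻¹ - 1‖) * ‖x‖ *
          (1 / (R - ‖x‖) + 1 / (R - 2 * (‖s‖ + ‖s⁻¹‖) * ‖x‖)) *
          (poleCount f R + poleCount f⁻¹ R)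
        + 2 / α * (‖s - 1‖ ^ α + ‖s⁻¹ - 1‖ ^ α) * Real.log (‖x‖ + 3) ^ (α * σ) *
          (poleCount f R + poleCount f⁻¹ R)
        + Real.log 2 := by
  have hσ1 := one_le_of_logOrder hf hσ hconst
  have hord : ∀ z, meromorphicOrderAt f z ≠ ⊤ := by
    intro z hz
    refine hconst ⟨0, ?_⟩
    have hall : ∀ w, meromorphicOrderAt f w = ⊤ := by
      intro w
      by_contra hw
      exact hf.exists_meromorphicOrderAt_ne_top_iff_forall.1 ⟨w, hw⟩ z hz
    rw [EventuallyEq, eventually_iff, mem_codiscrete]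
    intro w
    rw [disjoint_principal_right, compl_compl]
    exact meromorphicOrderAt_eq_top_iff.1 (hall w)
  set S : Set ℂ := Function.support (MeromorphicOn.divisor f Set.univ) with hS
  set G : Set ℂ := {z | AnalyticAt ℂ f z ∧ f z ≠ 0} with hG
  have hGc : Gᶜ.Countable := by
    refine countable_compl_of_mem_codiscrete ?_
    have h1 := MeromorphicOn.eventually_codiscreteWithin_analyticAt f
      (hf.meromorphicOn (s := Set.univ))
    have h2 := (hf.meromorphicOn (s := Set.univ)).eventually_codiscreteWithin_apply_ne_zero
      fun z _ => hord z
    exact h1.and h2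
  have hSG : S ⊆ Gᶜ := by
    intro z hz hzG
    refine hz ?_
    rw [hf.meromorphicOn.divisor_apply (Set.mem_univ z),
      hzG.1.meromorphicNFAt.meromorphicOrderAt_eq_zero_iff.2 hzG.2]
    rfl
  have hSc : S.Countable := hGc.mono hSG
  -- The choice `1 / 2` gives the counting exponent `β = σ - 1/2`, which is below `σ` and
  -- nonnegative because `σ ≥ 1`.
  obtain ⟨C, ρ₀, hC, hgrow⟩ := exists_growth_bound hf hσ hσ1 (show (0 : ℝ) < 1 / 2 by norm_num)
  have hnear : ∀ t : ℝ, 0 < t → ∃ M : ℝ, FiniteLogMeasure {r : ℝ | M ≤ r ∧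
      ∃ c ∈ S, |t * r - ‖c‖| < 2 * (r / Real.log (r + 3) ^ σ)} := by
    intro t ht
    refine finiteLogMeasure_near (β := σ - 1 + 1 / 2) (C := C) (ρ₀ := ρ₀) hSc (by linarith)
      (by linarith) ht hC fun ρ hρ => ?_
    obtain ⟨F, hF1, hF2⟩ := exists_finset_card_le hf ρ
    exact ⟨F, hF1, hF2.trans (hgrow ρ hρ).2⟩
  have hsp : 0 < ‖s‖ := norm_pos_iff.2 hs0
  have hsip : 0 < ‖s⁻¹‖ := norm_pos_iff.2 (inv_ne_zero hs0)
  have hsi : 1 < ‖s⁻¹‖ := by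
    rw [norm_inv]
    exact (one_lt_inv₀ hsp).2 hs1
  -- The scales `1`, `|s|`, `|s⁻¹|` keep zeros and poles away from `x`, `u`, `v` respectively.
  obtain ⟨M₁, hM₁⟩ := hnear 1 one_pos
  obtain ⟨M₂, hM₂⟩ := hnear ‖s‖ hsp
  obtain ⟨M₃, hM₃⟩ := hnear ‖s⁻¹‖ hsip
  obtain ⟨r₀, -, hr₀⟩ := exists_awOp_points hs0 hs1
  obtain ⟨M₄, hM₄1, hM₄⟩ := exists_log_rpow_le σ (‖s‖ + ‖s⁻¹‖)
  refine ⟨_, ((((((finiteLogMeasure_Iio r₀).union (finiteLogMeasure_Iio M₄)).union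
    ((finiteLogMeasure_Iio M₁).union hM₁)).union ((finiteLogMeasure_Iio M₂).union hM₂)).union
    ((finiteLogMeasure_Iio M₃).union hM₃)).union (finiteLogMeasure_of_countable
    (countable_norm_related s hGc))), fun α hα hα1 x R hx hR => ?_⟩
  simp only [Set.mem_union, Set.mem_Iio, not_or, not_lt] at hx
  obtain ⟨⟨⟨⟨⟨hx0, hx4⟩, hx1, hE1⟩, hx2, hE2⟩, hx3, hE3⟩, hEc⟩ := hx
  obtain ⟨u, v, hD, huv, ⟨hux, huκ, hus, hup⟩, ⟨hvx, hvκ, hvs, hvp⟩⟩ := hr₀ x hx0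
  obtain ⟨hK, hlog⟩ := hM₄ _ hx4
  have hgood : ∀ w, x ^ 2 - (s + s⁻¹) * w * x + (w ^ 2 + ((s - s⁻¹) / 2) ^ 2) = 0 → w ∈ G := by
    intro w hw
    by_contra hne
    exact hEc ⟨x, Or.inr ⟨w, hne, hw⟩, rfl⟩
  have hxG : x ∈ G := by
    by_contra hne
    exact hEc ⟨x, Or.inl hne, rfl⟩
  set L := Real.log (‖x‖ + 3) ^ σ with hL
  have hL0 : 0 < L := Real.rpow_pos_of_pos (by linarith) σ
  have hdist : ∀ (t : ℝ) (w : ℂ), (∀ c ∈ S, 2 * (‖x‖ / L) ≤ |t * ‖x‖ - ‖c‖|) →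
      |‖w‖ - t * ‖x‖| ≤ ‖s‖ + ‖s⁻¹‖ → ∀ i, MeromorphicOn.divisor f Set.univ i ≠ 0 →
      ‖x‖ ≤ L * ‖w - i‖ := by
    intro t w h1 h2 i hi
    have h3 := h1 i hi
    have h4 := abs_norm_sub_norm_le w i
    have h5 := abs_sub_le (t * ‖x‖) ‖w‖ ‖i‖
    rw [abs_sub_comm ‖w‖ (t * ‖x‖)] at h2
    have h6 : ‖x‖ / L ≤ ‖w - i‖ := by linarith
    rwa [div_le_iff₀' hL0] at h6
  have hdx := hdist 1 x (fun c hc => not_lt.1 fun h => hE1 ⟨hx1, c, hc, h⟩) (by simp; positivity)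
  have hdu := hdist ‖s‖ u (fun c hc => not_lt.1 fun h => hE2 ⟨hx2, c, hc, h⟩) hus
  have hdv := hdist ‖s⁻¹‖ v (fun c hc => not_lt.1 fun h => hE3 ⟨hx3, c, hc, h⟩) hvs
  set A := ‖s - 1‖ + ‖s⁻¹ - 1‖ with hA
  set κ := 2 * (‖s‖ + ‖s⁻¹‖) with hκ
  have hA0 : 0 ≤ A := by positivity
  have hκ1 : 1 ≤ κ := by linarith
  have hbu := posLog_norm_div_le_of_near hf hord hA0 hκ1 hL0.le hR hux huκ hxG.1 hxG.2
    (hgood u hup).1 (hgood u hup).2 hα hα1 hdx hdu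
  have hbv := posLog_norm_div_le_of_near hf hord hA0 hκ1 hL0.le hR hvx hvκ hxG.1 hxG.2
    (hgood v hvp).1 (hgood v hvp).2 hα hα1 hdx hdv
  have hnorm : ‖awOp s f x / f x‖ ≤ ‖f u / f x‖ + ‖f v / f x‖ := by
    have e : awOp s f x / f x = (f u / f x - f v / f x) / (u - v) := by
      rw [hD, div_right_comm, sub_div]
    rw [e, norm_div]
    exact (div_le_self (norm_nonneg _) huv).trans (norm_sub_le _ _)
  have hpl := (Real.posLog_le_posLog (norm_nonneg _) hnorm).trans Real.posLog_add
  have hAα : A ^ α ≤ ‖s - 1‖ ^ α + ‖s⁻¹ - 1‖ ^ α :=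
    Real.rpow_add_le_add_rpow (norm_nonneg _) (norm_nonneg _) hα.le hα1.le
  have hLα : L ^ α = Real.log (‖x‖ + 3) ^ (α * σ) := by
    rw [hL, ← Real.rpow_mul (by linarith), mul_comm]
  have hN : 0 ≤ poleCount f R + poleCount f⁻¹ R :=
    add_nonneg (poleCount_nonneg _ _) (poleCount_nonneg _ _)
  rw [hLα] at hbu hbv
  set P := Real.log (‖x‖ + 3) ^ (α * σ) with hP
  have hP0 : 0 ≤ P := Real.rpow_nonneg (by linarith) _
  have hthird : 2 * (A ^ α * P / α) * (poleCount f R + poleCount f⁻¹ R) ≤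
      2 / α * (‖s - 1‖ ^ α + ‖s⁻¹ - 1‖ ^ α) * P * (poleCount f R + poleCount f⁻¹ R) := by
    have e : 2 * (A ^ α * P / α) = 2 / α * A ^ α * P := by ring
    rw [e]
    gcongr
  have e1 : 4 * R * A * ‖x‖ / ((R - ‖x‖) * (R - κ * ‖x‖))
      = 2 * (2 * R * A * ‖x‖ / ((R - ‖x‖) * (R - κ * ‖x‖))) := by ring
  rw [e1]
  linarith

/-! ### Asymptotic estimates with `R = r ^ 2` -/

/-- Both denominators are at least `r ^ 2 / 2`, so the coefficient of `M` is at most `16 A / r`;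
this leaves a whole factor `r` to spare in the bound for `M`. -/
lemma proximity_term_le {A κ c r Y M : ℝ} (hA : 0 ≤ A) (hr : 3 ≤ r)
    (hκ : 2 * κ ≤ r) (hM0 : 0 ≤ M) (hM : M ≤ c * (Y * r)) :
    4 * r ^ 2 * A * r / ((r ^ 2 - r) * (r ^ 2 - κ * r)) * M ≤ 16 * A * c * Y := by
  have hr0 : 0 < r := by linarith
  have h1 : r ^ 2 / 2 ≤ r ^ 2 - r := by nlinarith
  have h2 : r ^ 2 / 2 ≤ r ^ 2 - κ * r := by nlinarith
  have h3 : 0 < r ^ 2 / 2 := by positivity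
  have h4 : 0 ≤ r ^ 2 - r := h3.le.trans h1
  calc _ ≤ 4 * r ^ 2 * A * r / (r ^ 2 / 2 * (r ^ 2 / 2)) * (c * (Y * r)) := by gcongr
    _ = _ := by
      field_simp
      ring

lemma poleCount_term_le {A κ c r Y N : ℝ} (hA : 0 ≤ A) (hc : 0 ≤ c) (hY : 0 ≤ Y) (hr : 3 ≤ r)
    (hκ : 2 * κ ≤ r) (hN0 : 0 ≤ N) (hN : N ≤ c * Y) :
    2 * A * r * (1 / (r ^ 2 - r) + 1 / (r ^ 2 - κ * r)) * N ≤ 8 * A * c * Y := by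
  have hr0 : 0 < r := by linarith
  have h1 : r ^ 2 / 2 ≤ r ^ 2 - r := by nlinarith
  have h2 : r ^ 2 / 2 ≤ r ^ 2 - κ * r := by nlinarith
  have h3 : 0 < r ^ 2 / 2 := by positivity
  calc _ ≤ 2 * A * r * (1 / (r ^ 2 / 2) + 1 / (r ^ 2 / 2)) * (c * Y) := by gcongr
    _ = 8 * A * c * Y / r := by
      field_simp
      ring
    _ ≤ _ := div_le_self (by positivity) (by linarith)

/-- The growth of the right-hand side of the pointwise estimate for `R = r²`. -/
lemma pointwise_bound_sq_le {A B κ C σ ε p r M N : ℝ} (hA : 0 ≤ A) (hB : 0 ≤ B) (hC : 0 ≤ C)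
    (hσ : 1 ≤ σ) (hε : 0 < ε) (hp0 : 0 ≤ p) (hp : p ≤ ε / 2) (hr : 3 ≤ r) (hκ : 2 * κ ≤ r)
    (hM0 : 0 ≤ M) (hN0 : 0 ≤ N) (hM : M ≤ C * Real.log (r ^ 2) ^ (σ + ε / 2))
    (hN : N ≤ C * Real.log (r ^ 2) ^ (σ - 1 + ε / 2)) :
    4 * r ^ 2 * A * r / ((r ^ 2 - r) * (r ^ 2 - κ * r)) * M
      + 2 * A * r * (1 / (r ^ 2 - r) + 1 / (r ^ 2 - κ * r)) * N
      + B * Real.log (r + 3) ^ p * N + Real.log 2 ≤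
    (16 * A * (C * 2 ^ (σ + ε / 2)) + 8 * A * (C * 2 ^ (σ - 1 + ε / 2)) +
      B * (C * 2 ^ (σ - 1 + ε)) + 1) * Real.log r ^ (σ - 1 + ε) := by
  have hr0 : 0 < r := by linarith
  have hl1 : 1 ≤ Real.log r := by
    rw [Real.le_log_iff_exp_le hr0]
    linarith [Real.exp_one_lt_d9]
  have hlr : Real.log r ≤ r := (Real.log_le_sub_one_of_pos hr0).trans (by linarith)
  have hlog2 : Real.log (r ^ 2) = 2 * Real.log r := by rw [Real.log_pow]; push_cast; rfl
  have hlog3 : Real.log (r + 3) ≤ 2 * Real.log r := by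
    rw [← hlog2]
    exact Real.log_le_log (by linarith) (by nlinarith)
  have hlog30 : 0 ≤ Real.log (r + 3) := Real.log_nonneg (by linarith)
  rw [hlog2] at hM hN
  generalize Real.log r = l at *
  have hl0 : 0 ≤ l := by linarith
  have hY1 : 1 ≤ l ^ (σ - 1 + ε) := Real.one_le_rpow hl1 (by linarith)
  have hY' : l ^ (σ - 1 + ε / 2) ≤ l ^ (σ - 1 + ε) :=
    Real.rpow_le_rpow_of_exponent_le hl1 (by linarith)
  -- The surplus factor `log r` in the proximity bound is estimated by `r`.
  have hM' : M ≤ C * 2 ^ (σ + ε / 2) * (l ^ (σ - 1 + ε) * r) := by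
    refine hM.trans ?_
    rw [Real.mul_rpow two_pos.le hl0, mul_assoc]
    have e : l ^ (σ + ε / 2) = l ^ (σ - 1 + ε / 2) * l := by
      rw [← Real.rpow_add_one (by linarith)]
      congr 1
      ring
    rw [e]
    gcongr
  have hN' : N ≤ C * 2 ^ (σ - 1 + ε / 2) * l ^ (σ - 1 + ε) := by
    refine hN.trans ?_
    rw [Real.mul_rpow two_pos.le hl0, mul_assoc]
    gcongr
  have hT1 := proximity_term_le hA hr hκ hM0 hM'
  have hT2 := poleCount_term_le hA (by positivity) (by positivity) hr hκ hN0 hN'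
  -- This term sets the exponent: half of `ε` pays for the power `p`, the other half for the
  -- counting bound.
  have hT3 : B * Real.log (r + 3) ^ p * N ≤ B * (C * 2 ^ (σ - 1 + ε)) * l ^ (σ - 1 + ε) := by
    have h1 : Real.log (r + 3) ^ p ≤ (2 * l) ^ (ε / 2) :=
      (Real.rpow_le_rpow hlog30 hlog3 hp0).trans
        (Real.rpow_le_rpow_of_exponent_le (by linarith) hp)
    have e : C * 2 ^ (σ - 1 + ε) * l ^ (σ - 1 + ε)
        = (2 * l) ^ (ε / 2) * (C * (2 * l) ^ (σ - 1 + ε / 2)) := by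
      rw [mul_assoc, ← Real.mul_rpow two_pos.le hl0, mul_left_comm,
        ← Real.rpow_add (by linarith)]
      ring_nf
    rw [mul_assoc B (C * _), e, mul_assoc B]
    gcongr
  have hT4 : Real.log 2 ≤ l ^ (σ - 1 + ε) := by linarith [Real.log_two_lt_d9]
  linarith

/-- Choosing `R = |x|²` in the pointwise estimate. -/
theorem exists_isBigO_bound {s : ℂ} (hs0 : s ≠ 0) (hs1 : ‖s‖ < 1) {f : ℂ → ℂ} {σ ε : ℝ}
    (hf : Meromorphic f) (hσ : logOrder f = (σ : EReal))
    (hconst : ¬ ∃ a : ℂ, f =ᶠ[codiscrete ℂ] fun _ => a) (hε : 0 < ε) :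
    ∃ E : Set ℝ, FiniteLogMeasure E ∧ ∃ C r₁ : ℝ, ∀ x : ℂ, r₁ ≤ ‖x‖ → ‖x‖ ∉ E →
      Real.posLog ‖awOp s f x / f x‖ ≤ C * Real.log ‖x‖ ^ (σ - 1 + ε) := by
  have hσ1 := one_le_of_logOrder hf hσ hconst
  obtain ⟨E, hE, hbound⟩ := exists_exceptional_set hs0 hs1 hf hσ hconst
  obtain ⟨C, r₀, hC, hgrow⟩ := exists_growth_bound hf hσ hσ1 (half_pos hε)
  have hσ0 : 0 < σ := by linarith
  obtain ⟨α, hα, hα1, hασ⟩ : ∃ α : ℝ, 0 < α ∧ α < 1 ∧ α * σ ≤ ε / 2 := by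
    refine ⟨min (1 / 2) (ε / 2 / σ), by positivity, ?_, ?_⟩
    · exact (min_le_left _ _).trans_lt (by norm_num)
    · calc _ ≤ ε / 2 / σ * σ := by gcongr; exact min_le_right _ _
        _ = ε / 2 := div_mul_cancel₀ _ hσ0.ne'
  refine ⟨E, hE, 16 * (‖s - 1‖ + ‖s⁻¹ - 1‖) * (C * 2 ^ (σ + ε / 2))
      + 8 * (‖s - 1‖ + ‖s⁻¹ - 1‖) * (C * 2 ^ (σ - 1 + ε / 2))
      + 2 / α * (‖s - 1‖ ^ α + ‖s⁻¹ - 1‖ ^ α) * (C * 2 ^ (σ - 1 + ε)) + 1,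
    max (max r₀ 3) (2 * (2 * (‖s‖ + ‖s⁻¹‖))), fun x hx hxE => ?_⟩
  have hxr₀ : r₀ ≤ ‖x‖ := ((le_max_left _ _).trans (le_max_left _ _)).trans hx
  have hx3 : 3 ≤ ‖x‖ := ((le_max_right _ _).trans (le_max_left _ _)).trans hx
  have hxκ : 2 * (2 * (‖s‖ + ‖s⁻¹‖)) ≤ ‖x‖ := (le_max_right _ _).trans hx
  obtain ⟨hM, hN⟩ := hgrow (‖x‖ ^ 2) (hxr₀.trans (by nlinarith))
  exact (hbound α hα hα1 x (‖x‖ ^ 2) hxE (by nlinarith)).trans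
    (pointwise_bound_sq_le (by positivity) (by positivity) hC hσ1 hε (by positivity) hασ hx3 hxκ
      (add_nonneg (proximity_nonneg _) (proximity_nonneg _))
      (add_nonneg (poleCount_nonneg _ _) (poleCount_nonneg _ _)) hM hN)

/-- An undefined circle average is `0 ≤ K`, so no integrability of `𝒟_q f / f` on circles has to be
established. -/
lemma proximity_le_of_forall_le {g : ℂ → ℂ} {r K : ℝ} (hr : 0 ≤ r) (hK : 0 ≤ K)
    (h : ∀ x : ℂ, ‖x‖ = r → Real.posLog ‖g x‖ ≤ K) : proximity g ⊤ r ≤ K := by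
  rw [proximity_top]
  by_cases hint : CircleIntegrable (fun x => Real.posLog ‖g x‖) 0 r
  · exact Real.circleAverage_mono_on_of_le_circle hint fun x hx => h x (by
      simpa [abs_of_nonneg hr] using hx)
  · rw [Real.circleAverage.integral_undef hint]
    exact hK

/-- A pointwise bound outside an exceptional set of radii gives both asymptotic estimates. -/
lemma isBigO_of_bound {g : ℂ → ℂ} {E : Set ℝ} {C r₁ p : ℝ}
    (h : ∀ x : ℂ, r₁ ≤ ‖x‖ → ‖x‖ ∉ E → Real.posLog ‖g x‖ ≤ C * Real.log ‖x‖ ^ p) :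
    ((fun x : ℂ => Real.posLog ‖g x‖) =O[Bornology.cobounded ℂ ⊓ 𝓟 {x : ℂ | ‖x‖ ∉ E}]
        fun x : ℂ => Real.log ‖x‖ ^ p) ∧
      ((fun r : ℝ => proximity g ⊤ r) =O[atTop ⊓ 𝓟 Eᶜ] fun r : ℝ => Real.log r ^ p) := by
  have h' : ∀ x : ℂ, max r₁ 1 ≤ ‖x‖ → ‖x‖ ∉ E →
      Real.posLog ‖g x‖ ≤ |C| * ‖Real.log ‖x‖ ^ p‖ := by
    intro x hx hxE
    refine (h x ((le_max_left _ _).trans hx) hxE).trans ?_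
    rw [Real.norm_eq_abs, ← abs_mul]
    exact le_abs_self _
  constructor
  · refine IsBigO.of_bound |C| ?_
    rw [eventually_inf_principal]
    filter_upwards [tendsto_norm_cobounded_atTop.eventually_ge_atTop (max r₁ 1)] with x hx hxE
    rw [Real.norm_of_nonneg Real.posLog_nonneg]
    exact h' x hx hxE
  · refine IsBigO.of_bound |C| ?_
    rw [eventually_inf_principal]
    filter_upwards [eventually_ge_atTop (max r₁ 1)] with r hr hrE
    rw [Real.norm_of_nonneg (proximity_nonneg r)]
    refine proximity_le_of_forall_le (zero_le_one.trans ((le_max_right _ _).trans hr))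
      (by positivity) fun x hx => ?_
    subst hx
    exact h' x hr hrE

end AskeyWilson

/-! ### The main theorem -/

theorem theoremT :
    ∃ D : ℝ → ℝ, (∀ α : ℝ, 0 < α → α < 1 → 0 < D α) ∧
      ∀ (q s : ℂ), q ≠ 0 → ‖q‖ < 1 → s ^ 2 = q →
      ∀ (f : ℂ → ℂ) (σ : ℝ), Meromorphic f → AskeyWilson.logOrder f = (σ : EReal) →
      ¬ (AskeyWilson.awOp s f =ᶠ[codiscrete ℂ] 0) →
        -- the pointwise inequality with free parameters `α` and `R`
        (∀ α : ℝ, 0 < α → α < 1 →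
          ∃ E : Set ℝ, AskeyWilson.FiniteLogMeasure E ∧
            ∀ (x : ℂ) (R : ℝ), ‖x‖ ∉ E → 2 * (‖s‖ + ‖s⁻¹‖) * ‖x‖ < R →
              Real.posLog ‖AskeyWilson.awOp s f x / f x‖ ≤
                4 * R * (‖s - 1‖ + ‖s⁻¹ - 1‖) * ‖x‖ /
                    ((R - ‖x‖) * (R - 2 * (‖s‖ + ‖s⁻¹‖) * ‖x‖)) *
                  (ValueDistribution.proximity f ⊤ R + ValueDistribution.proximity f⁻¹ ⊤ R)
                + 2 * (‖s - 1‖ + ‖s⁻¹ - 1‖) * ‖x‖ *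
                  (1 / (R - ‖x‖) + 1 / (R - 2 * (‖s‖ + ‖s⁻¹‖) * ‖x‖)) *
                  (AskeyWilson.poleCount f R + AskeyWilson.poleCount f⁻¹ R)
                + D α * (‖s - 1‖ ^ α + ‖s⁻¹ - 1‖ ^ α) * Real.log (‖x‖ + 3) ^ (α * σ) *
                  (AskeyWilson.poleCount f R + AskeyWilson.poleCount f⁻¹ R)
                + Real.log 2) ∧
        -- the asymptotic estimates
        (∀ ε : ℝ, 0 < ε →
          ∃ E : Set ℝ, AskeyWilson.FiniteLogMeasure E ∧
            ((fun x : ℂ => Real.posLog ‖AskeyWilson.awOp s f x / f x‖)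
              =O[Bornology.cobounded ℂ ⊓ 𝓟 {x : ℂ | ‖x‖ ∉ E}]
                fun x : ℂ => Real.log ‖x‖ ^ (σ - 1 + ε)) ∧
            ((fun r : ℝ => ValueDistribution.proximity
                (fun x : ℂ => AskeyWilson.awOp s f x / f x) ⊤ r)
              =O[atTop ⊓ 𝓟 Eᶜ]
                fun r : ℝ => Real.log r ^ (σ - 1 + ε))) := by
  -- One factor `1 / α` for each of the two shifted points.
  refine ⟨fun α => 2 / α, fun α hα _ => by positivity, ?_⟩
  intro q s hq0 hq1 hsq f σ hf hσ _
  have hs0 : s ≠ 0 := by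
    rintro rfl
    exact hq0 (by rw [← hsq]; simp)
  have hs1 : ‖s‖ < 1 := by
    rw [← hsq, norm_pow] at hq1
    exact lt_of_pow_lt_pow_left₀ 2 zero_le_one (by simpa using hq1)
  -- For such `f` the bound `σ ≥ 1` is not available, but both left-hand sides vanish off the
  -- exceptional set.
  by_cases hconst : ∃ a : ℂ, f =ᶠ[codiscrete ℂ] fun _ => a
  · obtain ⟨a, ha⟩ := hconst
    obtain ⟨E, hE, hzero⟩ := AskeyWilson.exists_awOp_eq_zero hs0 hs1 ha
    refine ⟨fun α hα _ => ⟨E, hE, fun x R hx hR => ?_⟩, fun ε _ => ⟨E, hE, ?_⟩⟩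
    · rw [hzero x hx, zero_div, norm_zero, Real.posLog_zero]
      have hsi : 1 < ‖s⁻¹‖ := by
        rw [norm_inv]
        exact (one_lt_inv₀ (norm_pos_iff.2 hs0)).2 hs1
      have h1 : ‖x‖ ≤ 2 * (‖s‖ + ‖s⁻¹‖) * ‖x‖ :=
        le_mul_of_one_le_left (norm_nonneg x) (by linarith [norm_nonneg s])
      have h2 : 0 < R - 2 * (‖s‖ + ‖s⁻¹‖) * ‖x‖ := by linarith
      have h3 : 0 < R - ‖x‖ := by linarith
      have h4 : 0 < R := by linarith [norm_nonneg x]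
      have h5 : 0 ≤ ValueDistribution.proximity f ⊤ R + ValueDistribution.proximity f⁻¹ ⊤ R :=
        add_nonneg (ValueDistribution.proximity_nonneg _) (ValueDistribution.proximity_nonneg _)
      have h6 : 0 ≤ AskeyWilson.poleCount f R + AskeyWilson.poleCount f⁻¹ R :=
        add_nonneg (AskeyWilson.poleCount_nonneg _ _) (AskeyWilson.poleCount_nonneg _ _)
      have h7 : 0 ≤ Real.log (‖x‖ + 3) := Real.log_nonneg (by linarith [norm_nonneg x])
      have h8 : 0 ≤ Real.log 2 := Real.log_nonneg one_le_two
      positivity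
    · refine AskeyWilson.isBigO_of_bound (C := 0) (r₁ := 0) fun x _ hx => ?_
      rw [hzero x hx, zero_div, norm_zero, Real.posLog_zero, zero_mul]
  · refine ⟨fun α hα hα1 => ?_, fun ε hε => ?_⟩
    · obtain ⟨E, hE, h⟩ := AskeyWilson.exists_exceptional_set hs0 hs1 hf hσ hconst
      exact ⟨E, hE, h α hα hα1⟩
    · obtain ⟨E, hE, C, r₁, h⟩ := AskeyWilson.exists_isBigO_bound hs0 hs1 hf hσ hconst hε
      exact ⟨E, hE, AskeyWilson.isBigO_of_bound h⟩
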